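/- Let $L_1,L_2,\dots$ be natural numbers, let $\mathcal A=\prod_{j\ge1}\{1,\dots,L_j\}$ with its product topology and Borel $\sigma$-algebra, and let $X_j(a)=a_j$. Let $\mathbb R^\infty$ be the space of real vectors $\beta=(\beta_{jl})_{j\ge1,\,1\le l\le L_j}$, and let $$P=\{\beta\in\mathbb R^\infty : 0\le\beta_{jl}\le1 \text{ for all } j,l,\ \textstyle\sum_{l=1}^{L_j}\beta_{jl}=1\text{ for all }j\}.$$ For $\beta\in P$ let $\mathsf P_\beta$ be the distribution on $\mathcal A$ under which the $X_j$ are independent with $\mathsf P_\beta(X_j=l)=\beta_{jl}$. Fix linearly independent vectors $\lambda^1,\dots,\lambda^K\in P$; for $g\in\mathbb R^K$ put $\beta(g)=\sum_{k=1}^K g_k\lambda^k$, let $Q=\{g\in\mathbb R^K:\beta(g)\in P\}$ (a compact convex set of dimension $K-1$ in the hyperplane $\sum_k g_k=1$), and write $\mathsf P_g=\mathsf P_{\beta(g)}$ for $g\in Q$. Let $\mathcal P(Q)$ be the set of Borel probability measures on $Q$, with the topology of weak convergence. For $\mu\in\mathcal P(Q)$ let $\mathsf P_\mu(A)=\int_Q\mathsf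 P_g(A)\,\mu(dg)$, and let $\nu[\mu]$ be the probability measure on $\Omega=Q\times\mathcal A$ with $\nu[\mu](B\times A)=\int_B\mathsf P_g(A)\,\mu(dg)$ for Borel $B\subseteq Q$, $A\subseteq\mathcal A$. On $\Omega$ put $G(g,a)=g$, $X_j(g,a)=a_j$, $\mathcal F^n=\sigma(X_1,\dots,X_n)$ and $\mathcal F^\infty=\sigma(X_1,X_2,\dots)$. The conditional expectations under $\nu[\mu]$ of $G$ given $\mathcal F^n$ and given $\mathcal F^\infty$ do not depend on $g$; let $e_n[\mu],e_\infty[\mu]:\mathcal A\to Q$ be measurable maps with $e_n[\mu](a)=\mathsf E(G\mid\mathcal F^n)(g,a)$ and $e_\infty[\mu](a)=\mathsf E(G\mid\mathcal F^\infty)(g,a)$ for $\nu[\mu]$-almost all $(g,a)$, where $e_n[\mu](a)$ depends only on $a_1,\dots,a_n$. Let $\hat\mu_n[\mu]$ and $\hat\mu_\infty[\mu]$ be the images of $\mathsf P_\mu$ under $e_n[\mu]$ and $e_\infty[\mu]$. Let $\mathcal X=\bigcap_n\sigma(X_n,X_{n+1},\dots)$ be the tail $\sigma$-algebra on $\mathcal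 A$. A $\sigma$-algebra $\mathcal G\subseteq\mathcal B(\mathcal A)$ is called sufficient for a family of probability measures on $\mathcal A$ if there is a function $P(a,B)$ ($a\in\mathcal A$, $B\in\mathcal B(\mathcal A)$) such that $P(\cdot,B)$ is $\mathcal G$-measurable for every $B$, $P(a,\cdot)$ is a probability measure for every $a$, and for every member $\mathsf P'$ of the family and every $B$, $P(\cdot,B)=\mathsf P'(B\mid\mathcal G)$ holds $\mathsf P'$-a.s. Then the following nine conditions are equivalent: 1. For every $\mu\in\mathcal P(Q)$, $\hat\mu_n[\mu]$ converges weakly to $\mu$ as $n\to\infty$. 2. For every $\mu\in\mathcal P(Q)$, $\hat\mu_\infty[\mu]=\mu$. 3. For every $\mu\in\mathcal P(Q)$, $\nu[\mu](\{(g,a): g=e_\infty[\mu](a)\})=1$. 4. For every $\mu\in\mathcal P(Q)$, $G=\mathsf E(G\mid\mathcal F^\infty)$ $\nu[\mu]$-a.s. 5. For every $\mu\in\mathcal P(Q)$ there is a variant $P(\omega,B)$ ($\omega\in\Omega$, $B\in\mathcal B(Q)$) of the regular conditional distribution of $G$ with respect to $\mathcal F^\infty$ under $\nu[\mu]$ such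 that for every $\omega\in\Omega$ the distribution $P(\omega,\cdot)$ is concentrated at a single point. 6. For every $\mu\in\mathcal P(Q)$ there is a Borel set $Q_1\subseteq Q$ with $\mu(Q_1)=1$ such that $\mathcal X$ is sufficient for the family $\{\mathsf P_g: g\in Q_1\}$. 7. For all $g',g''\in Q$ with $g'\ne g''$, $\mathsf P_{g'}\perp\mathsf P_{g''}$. 8. For all $g',g''\in Q$ with $g'\ne g''$, $\displaystyle\prod_{j=1}^\infty\sum_{l=1}^{L_j}\sqrt{\beta_{jl}(g')\,\beta_{jl}(g'')}=0$. 9. For all $g',g''\in Q$ with $g'\ne g''$, $\displaystyle\sum_{j=1}^\infty\sum_{l=1}^{L_j}\left(\sqrt{\beta_{jl}(g')}-\sqrt{\beta_{jl}(g'')}\right)^2=\infty$. -/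

import Mathlib

open MeasureTheory ProbabilityTheory Filter Topology

namespace LLS

/-- The space `𝓐 = ∏ⱼ {1, …, Lⱼ}` of outcome sequences (everything is indexed from `0`), with the
product σ-algebra, which is the Borel σ-algebra of the product topology. -/
abbrev Outcomes (L : ℕ → ℕ) : Type := (j : ℕ) → Fin (L j)

/-- The space `ℝ^∞` of all vectors `(β_{jl})`, with the product topology. -/
abbrev BetaSpace (L : ℕ → ℕ) : Type := (j : ℕ) → Fin (L j) → ℝ

/-- The convex body `P` of those `β` which describe independent distributions. -/
def paramBody (L : ℕ → ℕ) : Set (BetaSpace L) :=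
  {β | (∀ j l, 0 ≤ β j l ∧ β j l ≤ 1) ∧ ∀ j, ∑ l, β j l = 1}

/-- The distribution on `{1, …, Lⱼ}` which gives mass `β_{jl}` to the point `l`. -/
noncomputable def coordMeasure {L : ℕ → ℕ} (β : BetaSpace L) (j : ℕ) : Measure (Fin (L j)) :=
  ∑ l, ENNReal.ofReal (β j l) • Measure.dirac l

instance coordMeasure_isProbabilityMeasure {L : ℕ → ℕ} (β : paramBody L) (j : ℕ) :
    IsProbabilityMeasure (coordMeasure β.1 j) := by
  constructor
  simp only [coordMeasure, Measure.coe_finsetSum, Finset.sum_apply, Measure.smul_apply,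
    measure_univ, smul_eq_mul, mul_one]
  rw [← ENNReal.ofReal_sum_of_nonneg fun l _ => (β.2.1 j l).1, β.2.2 j, ENNReal.ofReal_one]

/-- The independent distribution `P_β` on `𝓐` for which `Prob (X_j = l) = β_{jl}`. -/
noncomputable def indepMeasure {L : ℕ → ℕ} (β : paramBody L) : Measure (Outcomes L) :=
  Measure.infinitePi fun j => coordMeasure β.1 j

instance indepMeasure_isProbabilityMeasure {L : ℕ → ℕ} (β : paramBody L) :
    IsProbabilityMeasure (indepMeasure β) := by
  unfold indepMeasure; infer_instance

lemma measurable_coordMeasure_apply {L : ℕ → ℕ} (j : ℕ) (s : Set (Fin (L j))) :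
    Measurable fun β : paramBody L => coordMeasure β.1 j s := by
  have h : ∀ l : Fin (L j), Measurable fun β : paramBody L => ENNReal.ofReal (β.1 j l) := by
    intro l
    have : Continuous fun β : paramBody L => β.1 j l :=
      (continuous_apply l).comp ((continuous_apply j).comp continuous_subtype_val)
    exact ENNReal.measurable_ofReal.comp this.measurable
  simp only [coordMeasure, Measure.coe_finsetSum, Finset.sum_apply, Measure.smul_apply,
    smul_eq_mul]
  exact Finset.measurable_sum _ fun l _ => (h l).mul_const _

lemma measurable_indepMeasure (L : ℕ → ℕ) :
    Measurable fun β : paramBody L => indepMeasure β := by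
  apply Measurable.measure_of_isPiSystem_of_isProbabilityMeasure
    (generateFrom_squareCylinders (α := fun j => Fin (L j))).symm
    (isPiSystem_squareCylinders (fun _ => MeasurableSpace.isPiSystem_measurableSet) (by simp))
  rintro S ⟨s, t, ht, rfl⟩
  have ht' : ∀ i, MeasurableSet (t i) := fun i => ht i (Set.mem_univ i)
  simp only [indepMeasure, Measure.infinitePi_pi _ fun i _ => ht' i]
  exact Finset.measurable_prod _ fun j _ => measurable_coordMeasure_apply j _

section Family

variable {L : ℕ → ℕ} {K : ℕ}

/-- The linear map `β(g) = ∑ₖ gₖ λᵏ`. -/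
noncomputable def betaMap (lam : Fin K → BetaSpace L) (g : EuclideanSpace ℝ (Fin K)) : BetaSpace L :=
  ∑ k, g k • lam k

/-- The set `Q ⊆ ℝᴷ` of coordinates of the points of `P ∩ span (λ¹, …, λᴷ)`. -/
def paramSet (lam : Fin K → BetaSpace L) : Set (EuclideanSpace ℝ (Fin K)) :=
  {g | betaMap lam g ∈ paramBody L}

lemma continuous_betaMap (lam : Fin K → BetaSpace L) : Continuous (betaMap lam) := by
  unfold betaMap; fun_prop

lemma isClosed_paramBody (L : ℕ → ℕ) : IsClosed (paramBody L) := by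
  simp only [paramBody, Set.ofPred_and, Set.ofPred_forall]
  refine IsClosed.inter (isClosed_iInter fun j => isClosed_iInter fun l => IsClosed.inter ?_ ?_)
    (isClosed_iInter fun j => ?_)
  · exact isClosed_le (by fun_prop) (by fun_prop)
  · exact isClosed_le (by fun_prop) (by fun_prop)
  · exact isClosed_eq (by fun_prop) (by fun_prop)

lemma measurableSet_paramSet (lam : Fin K → BetaSpace L) : MeasurableSet (paramSet lam) :=
  ((isClosed_paramBody L).preimage (continuous_betaMap lam)).measurableSet

/-- The isomorphism `β : Q → P ∩ span (λ¹, …, λᴷ)`, as a map into `P`. -/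
noncomputable def betaBody (lam : Fin K → BetaSpace L) (g : paramSet lam) : paramBody L :=
  ⟨betaMap lam g.1, g.2⟩

lemma measurable_betaBody (lam : Fin K → BetaSpace L) : Measurable (betaBody lam) :=
  Continuous.measurable <|
    Continuous.subtype_mk ((continuous_betaMap lam).comp continuous_subtype_val) _

/-- The family `g ↦ P_g` of independent distributions, as a Markov kernel from `Q` to `𝓐`. -/
noncomputable def family (lam : Fin K → BetaSpace L) : Kernel (paramSet lam) (Outcomes L) where
  toFun g := indepMeasure (betaBody lam g)
  measurable' := (measurable_indepMeasure L).comp (measurable_betaBody lam)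

instance family_isMarkovKernel (lam : Fin K → BetaSpace L) : IsMarkovKernel (family lam) :=
  ⟨fun g => indepMeasure_isProbabilityMeasure (betaBody lam g)⟩

/-- The probability space `Ω = Q × 𝓐`. -/
abbrev Omega (lam : Fin K → BetaSpace L) : Type := paramSet lam × Outcomes L

/-- The random variable `G (g, a) = g`, with values in `ℝᴷ`. -/
def G (lam : Fin K → BetaSpace L) (ω : Omega lam) : EuclideanSpace ℝ (Fin K) := ω.1.1

/-- The joint distribution `ν[μ]` of `G, X₁, X₂, …`, i.e. `ν (B × A) = ∫_B P_g (A) μ(dg)`. -/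
noncomputable def nu {lam : Fin K → BetaSpace L} (μ : ProbabilityMeasure (paramSet lam)) :
    Measure (Omega lam) :=
  (μ : Measure (paramSet lam)) ⊗ₘ family lam

/-- The mixture `P_μ (A) = ∫ P_g (A) μ(dg)`. -/
noncomputable def mixture {lam : Fin K → BetaSpace L} (μ : ProbabilityMeasure (paramSet lam)) :
    ProbabilityMeasure (Outcomes L) :=
  ⟨(μ : Measure (paramSet lam)).bind (family lam), inferInstance⟩

end Family

/-- The σ-algebra on `𝓐` generated by the coordinates `X_j`, `j ∈ S`. -/
def sigmaX (L : ℕ → ℕ) (S : Set ℕ) : MeasurableSpace (Outcomes L) :=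
  ⨆ j ∈ S, MeasurableSpace.comap (fun a : Outcomes L => a j) ⊤

/-- The tail σ-algebra `𝓧 = ⋂ₙ σ(X_n, X_{n+1}, …)` on `𝓐`. -/
def tail (L : ℕ → ℕ) : MeasurableSpace (Outcomes L) :=
  ⨅ n : ℕ, sigmaX L {j | n ≤ j}

section Estimators

variable {L : ℕ → ℕ} {K : ℕ}

/-- The σ-algebra on `Ω = Q × 𝓐` generated by the random variables `X_j`, `j ∈ S`; it consists of
the cylinders `Q × A` with `A` in the σ-algebra generated by the same coordinates on `𝓐`. -/
def sigmaOmega (lam : Fin K → BetaSpace L) (S : Set ℕ) : MeasurableSpace (Omega lam) :=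
  (sigmaX L S).comap Prod.snd

/-- `𝓕ⁿ`, generated by the first `n` of the variables `X_j`. -/
def F (lam : Fin K → BetaSpace L) (n : ℕ) : MeasurableSpace (Omega lam) :=
  sigmaOmega lam {j | j < n}

/-- `𝓕^∞`, generated by all of the variables `X_j`. -/
def FInf (lam : Fin K → BetaSpace L) : MeasurableSpace (Omega lam) :=
  sigmaOmega lam Set.univ

lemma sigmaX_le (L : ℕ → ℕ) (S : Set ℕ) : sigmaX L S ≤ MeasurableSpace.pi :=
  iSup₂_le fun j _ => (measurable_pi_apply j).comap_le

lemma sigmaOmega_le (lam : Fin K → BetaSpace L) (S : Set ℕ) :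
    sigmaOmega lam S ≤ Prod.instMeasurableSpace :=
  (MeasurableSpace.comap_mono (sigmaX_le L S)).trans measurable_snd.comap_le

variable {lam : Fin K → BetaSpace L}

lemma nonempty_paramSet (μ : ProbabilityMeasure (paramSet lam)) : Nonempty (paramSet lam) :=
  (μ : Measure (paramSet lam)).nonempty_of_neZero

/-- A fixed point of `Q`. -/
noncomputable def basePoint (μ : ProbabilityMeasure (paramSet lam)) : paramSet lam :=
  Classical.choice (nonempty_paramSet μ)

/-- `E(G ∣ 𝓕)` does not depend on `g`. -/
lemma condExp_eq_of_fst (μ : ProbabilityMeasure (paramSet lam)) (S : Set ℕ)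
    (g g' : paramSet lam) (a : Outcomes L) :
    ((nu μ)[G lam | sigmaOmega lam S]) (g, a) = ((nu μ)[G lam | sigmaOmega lam S]) (g', a) := by
  have h : Measurable[sigmaOmega lam S] ((nu μ)[G lam | sigmaOmega lam S]) :=
    stronglyMeasurable_condExp.measurable
  obtain ⟨s, -, hs⟩ := h (measurableSet_singleton
    (((nu μ)[G lam | sigmaOmega lam S]) (g, a)))
  have h1 : (g, a) ∈ Prod.snd ⁻¹' s := by rw [hs]; rfl
  have h2 : (g', a) ∈ Prod.snd ⁻¹' s := h1
  rw [hs] at h2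
  exact h2.symm

open Classical in
/-- The function `e : 𝓐 → Q` with `e (a) = E(G ∣ 𝓕) (g, a)`, where `𝓕` is generated by the `X_j`
with `j ∈ S`. The right-hand side does not depend on `g`, so it is read off at one fixed `g`.
It lies in the closed convex set `Q` almost surely; where the chosen version of it does not,
`e` has a fixed value in `Q`. -/
noncomputable def condMean (μ : ProbabilityMeasure (paramSet lam)) (S : Set ℕ) (a : Outcomes L) :
    paramSet lam :=
  if h : ((nu μ)[G lam | sigmaOmega lam S]) (basePoint μ, a) ∈ paramSet lam then ⟨_, h⟩
  else basePoint μ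

lemma measurable_condMean (μ : ProbabilityMeasure (paramSet lam)) (S : Set ℕ) :
    Measurable (condMean μ S) := by
  have h : Measurable fun a : Outcomes L =>
      ((nu μ)[G lam | sigmaOmega lam S]) (basePoint μ, a) :=
    (stronglyMeasurable_condExp.mono (sigmaOmega_le lam S)).measurable.comp
      measurable_prodMk_left
  have hs := h (measurableSet_paramSet lam)
  classical
  exact Measurable.dite (f := fun a => ⟨_, a.2⟩) (g := fun _ => basePoint μ)
    (h.comp measurable_subtype_coe).subtype_mk measurable_const hs

/-- `eₙ[μ]`. -/
noncomputable def e (μ : ProbabilityMeasure (paramSet lam)) (n : ℕ) : Outcomes L → paramSet lam :=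
  condMean μ {j | j < n}

/-- `e_∞[μ]`. -/
noncomputable def eInf (μ : ProbabilityMeasure (paramSet lam)) : Outcomes L → paramSet lam :=
  condMean μ Set.univ

/-- The estimator `μ̂ₙ[μ]`, the image of `P_μ` under `eₙ[μ]`. -/
noncomputable def muHat (μ : ProbabilityMeasure (paramSet lam)) (n : ℕ) :
    ProbabilityMeasure (paramSet lam) :=
  (mixture μ).map (f := e μ n) (measurable_condMean μ _).aemeasurable

/-- `μ̂_∞[μ]`, the image of `P_μ` under `e_∞[μ]`. -/
noncomputable def muHatInf (μ : ProbabilityMeasure (paramSet lam)) :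
    ProbabilityMeasure (paramSet lam) :=
  (mixture μ).map (f := eInf μ) (measurable_condMean μ _).aemeasurable

end Estimators

/-- `P` is a variant of the regular conditional distribution of the random element `Y` with respect
to the σ-algebra `𝓕`, under the measure `ν`. -/
structure IsRegularCondDistrib {Ω E : Type*} (𝓕 : MeasurableSpace Ω) [MeasurableSpace Ω]
    [MeasurableSpace E] (ν : Measure Ω) (Y : Ω → E) (P : Ω → Measure E) : Prop where
  isProbabilityMeasure : ∀ ω, IsProbabilityMeasure (P ω)
  measurable : ∀ B, MeasurableSet B → Measurable[𝓕] fun ω => P ω B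
  ae_eq : ∀ B, MeasurableSet B → (fun ω => (P ω).real B) =ᵐ[ν] ν⟦Y ⁻¹' B | 𝓕⟧

/-- The σ-algebra `𝓖` is sufficient for the family `(p θ)`: one function `P` is a regular variant
of the conditional probability given `𝓖` for all members of the family at once. -/
def IsSufficient {Ω Θ : Type*} (𝓖 : MeasurableSpace Ω) [m : MeasurableSpace Ω]
    (p : Θ → Measure Ω) : Prop :=
  𝓖 ≤ m ∧ ∃ P : Ω → Measure Ω,
    (∀ B, MeasurableSet[m] B → Measurable[𝓖] fun ω => P ω B) ∧
    (∀ ω, IsProbabilityMeasure (P ω)) ∧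
    ∀ B, MeasurableSet[m] B → ∀ θ, (fun ω => (P ω).real B) =ᵐ[p θ] (p θ)⟦B | 𝓖⟧

end LLS

/-!
The implications run around the cycle mutual singularity ⇒ vanishing affinities ⇒ infinite Hellinger
distances ⇒ `G` is a function of the outcomes ⇒ mutual singularity; the other conditions are
reformulations of the last but one, or follow from the same estimator.

*Infinite Hellinger distances make `g` observable.* Put `p = ∑ₖ λᵏ`, so that `|β(g)| ≤ ‖g‖ p`, and
let `I(v, w) = ∑_{j,l} β_{jl}(v) β_{jl}(w) / p_{jl}`, summed over a block of coordinates `j`.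
Testing the hypothesis on pairs of points of `Q` symmetric about the barycentre shows that `I(v, v)`
over `j < n` tends to infinity for every `v ≠ 0` with `∑ₖ vₖ = 0`; in all other directions each
coordinate carries a fixed amount of information (`tendsto_info_atTop`). By compactness of the
sphere the divergence is uniform (`exists_mul_sq_norm_le_info`). If `I ≥ M` on the unit sphere and
`w` represents the `i`-th coordinate in `I`, the linear statistic `∑ⱼ β_{j,Xⱼ}(w) / p_{j,Xⱼ}` has
mean `gᵢ` and variance at most `‖g‖ I(w, w) ≤ ‖g‖ / M` under every `P_g`
(`exists_linear_estimator`). Blocks which move to infinity with `M = 2ᵏ` give estimators which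
converge almost surely; their limit is a tail measurable function `f` with `f = g` `P_g`-almost
surely, for all `g` at once (`exists_tail_estimator`). Hence `G = f(X)` under every prior, and
`P_{f(a)}` is a common version of the conditional probabilities given the tail, which are constants
by the zero-one law.

*Back to the distances.* With a prior charging both `g'` and `g''`, an almost sure reconstruction of
`G`, or sufficiency of the tail, separates `P_{g'}` from `P_{g''}`. Approximation of a separating
set by cylinders shows that the affinities vanish (`tendsto_prod_affinity_of_mutuallySingular`). For
a single pair a vanishing product need not mean a divergent sum, as one factor can be zero; passing
to two interior points of the segment from `g'` to `g''` removes this obstacle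
(`tendsto_sum_hellinger_of_tendsto_prod_affinity`).

*The Bayesian conditions.* Lévy's upward theorem gives `μ̂ₙ → μ̂_∞` for every prior
(`tendsto_muHat`). If `μ̂_∞ = μ`, then `G` and its conditional mean have the same variance, so the
conditional variance vanishes (`G_ae_eq_of_muHatInf_eq`).
-/

namespace LLS

/-! ### The convex body of parameters -/

section Body

variable {L : ℕ → ℕ} {K : ℕ} {lam : Fin K → BetaSpace L}

lemma betaMap_apply (g : EuclideanSpace ℝ (Fin K)) (j : ℕ) (l : Fin (L j)) :
    betaMap lam g j l = ∑ k, g k * lam k j l := by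
  simp [betaMap, Finset.sum_apply]

/-- `g ↦ β(g)` as a linear map. -/
noncomputable def betaLin (lam : Fin K → BetaSpace L) :
    EuclideanSpace ℝ (Fin K) →ₗ[ℝ] BetaSpace L where
  toFun := betaMap lam
  map_add' x y := by simp [betaMap, add_smul, Finset.sum_add_distrib]
  map_smul' c x := by simp [betaMap, mul_smul, Finset.smul_sum]

lemma betaMap_add (x y : EuclideanSpace ℝ (Fin K)) :
    betaMap lam (x + y) = betaMap lam x + betaMap lam y := (betaLin lam).map_add x y

lemma betaMap_sub (x y : EuclideanSpace ℝ (Fin K)) :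
    betaMap lam (x - y) = betaMap lam x - betaMap lam y := (betaLin lam).map_sub x y

lemma betaMap_smul (c : ℝ) (x : EuclideanSpace ℝ (Fin K)) :
    betaMap lam (c • x) = c • betaMap lam x := (betaLin lam).map_smul c x

lemma betaMap_injective (hlin : LinearIndependent ℝ lam) : Function.Injective (betaMap lam) := by
  intro x y hxy
  ext k
  have h0 : ∑ k, (x - y) k • lam k = 0 := by
    change betaMap lam (x - y) = 0
    rw [betaMap_sub, hxy, sub_self]
  have := Fintype.linearIndependent_iff.1 hlin _ h0 k
  simpa [sub_eq_zero] using this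

lemma convex_paramBody (L : ℕ → ℕ) : Convex ℝ (paramBody L) := by
  intro x hx y hy a b ha hb hab
  have hsum : ∀ j, ∑ l, (a • x + b • y) j l = 1 := by
    intro j
    simp only [Pi.add_apply, Pi.smul_apply, smul_eq_mul, Finset.sum_add_distrib,
      ← Finset.mul_sum, hx.2 j, hy.2 j]
    linarith
  refine ⟨fun j l => ⟨?_, ?_⟩, hsum⟩
  · exact add_nonneg (mul_nonneg ha (hx.1 j l).1) (mul_nonneg hb (hy.1 j l).1)
  · have h1 := mul_le_mul_of_nonneg_left (hx.1 j l).2 ha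
    have h2 := mul_le_mul_of_nonneg_left (hy.1 j l).2 hb
    simp only [Pi.add_apply, Pi.smul_apply, smul_eq_mul]
    linarith

lemma isCompact_paramBody (L : ℕ → ℕ) : IsCompact (paramBody L) := by
  have h : IsCompact (Set.pi Set.univ fun j : ℕ =>
      Set.pi Set.univ fun _ : Fin (L j) => Set.Icc (0 : ℝ) 1) :=
    isCompact_univ_pi fun j => isCompact_univ_pi fun l => isCompact_Icc
  exact h.of_isClosed_subset (isClosed_paramBody L) fun β hβ j _ l _ => hβ.1 j l

lemma isClosed_paramSet (lam : Fin K → BetaSpace L) : IsClosed (paramSet lam) :=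
  (isClosed_paramBody L).preimage (continuous_betaMap lam)

lemma convex_paramSet (lam : Fin K → BetaSpace L) : Convex ℝ (paramSet lam) :=
  (convex_paramBody L).linear_preimage (betaLin lam)

lemma isCompact_paramSet (hlin : LinearIndependent ℝ lam) : IsCompact (paramSet lam) :=
  (LinearMap.isClosedEmbedding_of_injective (f := betaLin lam)
    (LinearMap.ker_eq_bot.2 (betaMap_injective hlin))).isCompact_preimage (isCompact_paramBody L)

lemma mem_paramSet_of_nonneg_of_sum_eq_one (hmem : ∀ k, lam k ∈ paramBody L)
    {g : EuclideanSpace ℝ (Fin K)} (h0 : ∀ k, 0 ≤ g k) (h1 : ∑ k, g k = 1) : g ∈ paramSet lam :=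
  (convex_paramBody L).sum_mem (fun k _ => h0 k) h1 fun k _ => hmem k

end Body

/-! ### Hellinger affinities and Hellinger distances -/

section Hellinger

lemma sq_sqrt_sub_sqrt_mul_add_le {p q : ℝ} (hp : 0 ≤ p) (hq : 0 ≤ q) :
    (√p - √q) ^ 2 * (p + q) ≤ (p - q) ^ 2 := by
  obtain ⟨s, hs, rfl⟩ : ∃ s, 0 ≤ s ∧ s ^ 2 = p := ⟨√p, Real.sqrt_nonneg _, Real.sq_sqrt hp⟩
  obtain ⟨t, ht, rfl⟩ : ∃ s, 0 ≤ s ∧ s ^ 2 = q := ⟨√q, Real.sqrt_nonneg _, Real.sq_sqrt hq⟩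
  rw [Real.sqrt_sq hs, Real.sqrt_sq ht]
  have h : (s ^ 2 - t ^ 2) ^ 2 = (s - t) ^ 2 * (s ^ 2 + t ^ 2 + 2 * (s * t)) := by ring
  rw [h]
  exact mul_le_mul_of_nonneg_left (by nlinarith [mul_nonneg hs ht]) (sq_nonneg _)

/-- Moving two points of a segment towards each other decreases their Hellinger distance. -/
lemma sq_sqrt_sub_sqrt_trisect_le {p q : ℝ} (hp : 0 ≤ p) (hq : 0 ≤ q) :
    (√((2 * p + q) / 3) - √((p + 2 * q) / 3)) ^ 2 ≤ (√p - √q) ^ 2 := by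
  rcases (add_nonneg hp hq).eq_or_lt with h | h
  · obtain rfl : p = 0 := by linarith
    obtain rfl : q = 0 := by linarith
    simp
  have h1 := sq_sqrt_sub_sqrt_mul_add_le (p := (2 * p + q) / 3) (q := (p + 2 * q) / 3)
    (by positivity) (by positivity)
  obtain ⟨s, hs, rfl⟩ : ∃ s, 0 ≤ s ∧ s ^ 2 = p := ⟨√p, Real.sqrt_nonneg _, Real.sq_sqrt hp⟩
  obtain ⟨t, ht, rfl⟩ : ∃ s, 0 ≤ s ∧ s ^ 2 = q := ⟨√q, Real.sqrt_nonneg _, Real.sq_sqrt hq⟩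
  rw [Real.sqrt_sq hs, Real.sqrt_sq ht]
  refine le_of_mul_le_mul_right (a := s ^ 2 + t ^ 2) ?_ h
  have h2 : (s - t) ^ 2 * (s + t) ^ 2 ≤ (s - t) ^ 2 * (2 * (s ^ 2 + t ^ 2)) :=
    mul_le_mul_of_nonneg_left (by nlinarith [sq_nonneg (s - t)]) (sq_nonneg _)
  have h3 : 0 ≤ (s - t) ^ 2 * (s ^ 2 + t ^ 2) := by positivity
  have h4 : (2 * s ^ 2 + t ^ 2) / 3 + (s ^ 2 + 2 * t ^ 2) / 3 = s ^ 2 + t ^ 2 := by ring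
  rw [h4] at h1
  nlinarith

lemma sum_sq_sqrt_sub_sqrt {ι : Type*} [Fintype ι] {p q : ι → ℝ} (hp : ∀ i, 0 ≤ p i)
    (hq : ∀ i, 0 ≤ q i) (hp1 : ∑ i, p i = 1) (hq1 : ∑ i, q i = 1) :
    ∑ i, (√(p i) - √(q i)) ^ 2 = 2 * (1 - ∑ i, √(p i * q i)) := by
  have : ∀ i, (√(p i) - √(q i)) ^ 2 = p i + q i - 2 * √(p i * q i) := fun i => by
    rw [Real.sqrt_mul (hp i), sub_sq, Real.sq_sqrt (hp i), Real.sq_sqrt (hq i)]; ring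
  simp only [this, Finset.sum_sub_distrib, Finset.sum_add_distrib, hp1, hq1, ← Finset.mul_sum]
  ring

lemma one_sub_sum_one_sub_le_prod {ι : Type*} (s : Finset ι) {a : ι → ℝ} (h0 : ∀ j, 0 ≤ a j)
    (h1 : ∀ j, a j ≤ 1) : 1 - ∑ j ∈ s, (1 - a j) ≤ ∏ j ∈ s, a j := by
  classical
  induction s using Finset.induction_on with
  | empty => simp
  | insert i s hi ih =>
    rw [Finset.sum_insert hi, Finset.prod_insert hi]
    have hp : ∏ j ∈ s, a j ≤ 1 := Finset.prod_le_one (fun j _ => h0 j) fun j _ => h1 j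
    nlinarith [mul_nonneg (sub_nonneg.2 (h1 i)) (sub_nonneg.2 hp)]

/-- A product of factors in `(0, 1]` can only vanish in the limit if the sum of the defects
diverges. -/
lemma tendsto_sum_one_sub_atTop_of_tendsto_prod_zero {a : ℕ → ℝ} (h0 : ∀ j, 0 < a j)
    (h1 : ∀ j, a j ≤ 1)
    (h : Tendsto (fun n => ∏ j ∈ Finset.range n, a j) atTop (𝓝 0)) :
    Tendsto (fun n => ∑ j ∈ Finset.range n, (1 - a j)) atTop atTop := by
  have hnn : ∀ j, 0 ≤ 1 - a j := fun j => sub_nonneg.2 (h1 j)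
  rw [← not_summable_iff_tendsto_nat_atTop_of_nonneg hnn]
  intro hs
  obtain ⟨m, hm⟩ := ((tendsto_order.1 (tendsto_sum_nat_add fun j => 1 - a j)).2 (1 / 2)
    (by norm_num)).exists
  have hs' : Summable fun j => 1 - a (j + m) :=
    (summable_nat_add_iff m (f := fun j => 1 - a j)).2 hs
  have key : ∀ n, 1 / 2 ≤ ∏ j ∈ Finset.range n, a (j + m) := by
    intro n
    have hle : ∑ j ∈ Finset.range n, (1 - a (j + m)) ≤ 1 / 2 :=
      (hs'.sum_le_tsum _ fun j _ => hnn _).trans hm.le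
    linarith [one_sub_sum_one_sub_le_prod (Finset.range n) (fun j => (h0 (j + m)).le)
      fun j => h1 (j + m)]
  have hpos : 0 < ∏ j ∈ Finset.range m, a j := Finset.prod_pos fun j _ => h0 j
  have hlim := ge_of_tendsto (b := (∏ j ∈ Finset.range m, a j) * (1 / 2))
    ((tendsto_add_atTop_iff_nat m).2 h) (Eventually.of_forall fun n => by
      rw [add_comm n m, Finset.prod_range_add]
      simp only [add_comm m]
      exact mul_le_mul_of_nonneg_left (key n) hpos.le)
  linarith [half_pos hpos]

variable {L : ℕ → ℕ} {K : ℕ} {lam : Fin K → BetaSpace L}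

/-- If all Hellinger affinities vanish, then all Hellinger distances are infinite. For a single pair
of points this may fail, because one factor of the product may vanish; two interior points of the
segment between `g'` and `g''` have only positive factors. -/
lemma tendsto_sum_hellinger_of_tendsto_prod_affinity
    (h : ∀ g' g'' : paramSet lam, g' ≠ g'' →
      Tendsto (fun n : ℕ => ∏ j ∈ Finset.range n, ∑ l,
        √(betaMap lam g'.1 j l * betaMap lam g''.1 j l)) atTop (𝓝 0))
    {g' g'' : paramSet lam} (hne : g' ≠ g'') :
    Tendsto (fun n : ℕ => ∑ j ∈ Finset.range n, ∑ l,
      (√(betaMap lam g'.1 j l) - √(betaMap lam g''.1 j l)) ^ 2) atTop atTop := by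
  have hconv := convex_paramSet lam
  have hx := hconv g'.2 g''.2 (a := 2 / 3) (b := 1 / 3) (by norm_num) (by norm_num) (by norm_num)
  have hy := hconv g'.2 g''.2 (a := 1 / 3) (b := 2 / 3) (by norm_num) (by norm_num) (by norm_num)
  set x : paramSet lam := ⟨_, hx⟩ with hxdef
  set y : paramSet lam := ⟨_, hy⟩ with hydef
  have hxb : ∀ j l, betaMap lam x.1 j l =
      (2 * betaMap lam g'.1 j l + betaMap lam g''.1 j l) / 3 := by
    intro j l
    simp only [hxdef, betaMap_add, betaMap_smul, Pi.add_apply, Pi.smul_apply, smul_eq_mul]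
    ring
  have hyb : ∀ j l, betaMap lam y.1 j l =
      (betaMap lam g'.1 j l + 2 * betaMap lam g''.1 j l) / 3 := by
    intro j l
    simp only [hydef, betaMap_add, betaMap_smul, Pi.add_apply, Pi.smul_apply, smul_eq_mul]
    ring
  have hxy : x ≠ y := by
    intro hxy
    apply hne
    have h3 : (3 : ℝ) • (x.1 - y.1) = g'.1 - g''.1 := by
      simp only [hxdef, hydef]; module
    rw [hxy, sub_self, smul_zero] at h3
    exact Subtype.ext (sub_eq_zero.1 h3.symm)
  have hnn := fun (g : paramSet lam) j l => (g.2.1 j l).1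
  have heq := fun (g₁ g₂ : paramSet lam) j => sum_sq_sqrt_sub_sqrt (hnn g₁ j) (hnn g₂ j)
    (g₁.2.2 j) (g₂.2.2 j)
  -- wherever `β(g')` is positive, so are both trisection points
  have hpos : ∀ j, 0 < ∑ l, √(betaMap lam x.1 j l * betaMap lam y.1 j l) := by
    intro j
    obtain ⟨l, -, hl⟩ : ∃ l ∈ Finset.univ, 0 < betaMap lam g'.1 j l := by
      apply Finset.exists_lt_of_sum_lt
      simpa using (g'.2.2 j).symm ▸ one_pos
    refine Finset.sum_pos' (fun _ _ => Real.sqrt_nonneg _) ⟨l, Finset.mem_univ _, ?_⟩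
    have := hnn g'' j l
    rw [hxb, hyb]
    positivity
  have hle : ∀ j, ∑ l, √(betaMap lam x.1 j l * betaMap lam y.1 j l) ≤ 1 := by
    intro j
    have : 0 ≤ ∑ l, (√(betaMap lam x.1 j l) - √(betaMap lam y.1 j l)) ^ 2 :=
      Finset.sum_nonneg fun _ _ => sq_nonneg _
    linarith [heq x y j]
  have hdiv := tendsto_sum_one_sub_atTop_of_tendsto_prod_zero hpos hle (h x y hxy)
  refine tendsto_atTop_mono (fun n => Finset.sum_le_sum fun j _ => ?_) hdiv
  calc 1 - ∑ l, √(betaMap lam x.1 j l * betaMap lam y.1 j l)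
      ≤ ∑ l, (√(betaMap lam x.1 j l) - √(betaMap lam y.1 j l)) ^ 2 := by
        rw [heq]; linarith [hle j]
    _ ≤ _ := Finset.sum_le_sum fun l _ => by
        rw [hxb, hyb]
        exact sq_sqrt_sub_sqrt_trisect_le (hnn g' j l) (hnn g'' j l)

end Hellinger
/-! ### Singular product measures have vanishing affinity -/

section Affinity

/-- If `S` has small `P`-mass and `Sᶜ` has small `Q`-mass, then `P` and `Q` have small affinity. -/
lemma sum_sqrt_measureReal_singleton_le {X : Type*} [Fintype X] [MeasurableSpace X]
    [MeasurableSingletonClass X] (P Q : Measure X) [IsProbabilityMeasure P]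
    [IsProbabilityMeasure Q] (S : Set X) :
    ∑ x, √(P.real {x} * Q.real {x}) ≤ √(P.real S) + √(Q.real Sᶜ) := by
  classical
  have key : ∀ T : Finset X,
      ∑ x ∈ T, √(P.real {x} * Q.real {x}) ≤ √(P.real T) * √(Q.real T) := by
    intro T
    simp only [Real.sqrt_mul measureReal_nonneg]
    refine (Real.sum_sqrt_mul_sqrt_le T (fun _ => measureReal_nonneg)
      fun _ => measureReal_nonneg).trans_eq ?_
    rw [sum_measureReal_singleton, sum_measureReal_singleton]
  rw [← Finset.sum_add_sum_compl S.toFinset]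
  refine add_le_add ((key _).trans ?_) ((key _).trans ?_)
  · rw [Set.coe_toFinset]
    exact mul_le_of_le_one_right (Real.sqrt_nonneg _) (Real.sqrt_le_one.2 measureReal_le_one)
  · rw [Finset.coe_compl, Set.coe_toFinset]
    exact mul_le_of_le_one_left (Real.sqrt_nonneg _) (Real.sqrt_le_one.2 measureReal_le_one)

variable {L : ℕ → ℕ}

lemma coordMeasure_real_singleton (β : paramBody L) (j : ℕ) (l : Fin (L j)) :
    (coordMeasure β.1 j).real {l} = β.1 j l := by
  classical
  simp only [measureReal_def, coordMeasure, Measure.coe_finsetSum, Finset.sum_apply,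
    Measure.smul_apply, smul_eq_mul, Measure.dirac_apply, Set.indicator_apply,
    Set.mem_singleton_iff, Pi.one_apply]
  simp [ENNReal.toReal_ofReal (β.2.1 j l).1]

lemma prod_affinity_le (β γ : paramBody L) (s : Finset ℕ) (S : Set ((i : s) → Fin (L i))) :
    ∏ j ∈ s, ∑ l, √(β.1 j l * γ.1 j l) ≤
      √((indepMeasure β).real (cylinder s S)) + √((indepMeasure γ).real (cylinder s S)ᶜ) := by
  classical
  have hS : MeasurableSet S := S.toFinite.measurableSet
  have hreal : ∀ (δ : paramBody L) (T : Set ((i : s) → Fin (L i))),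
      (indepMeasure δ).real (cylinder s T) =
        (Measure.pi fun i : s => coordMeasure δ.1 i).real T := by
    intro δ T
    rw [measureReal_def, indepMeasure, Measure.infinitePi_cylinder _ T.toFinite.measurableSet,
      measureReal_def]
  rw [compl_cylinder, hreal, hreal]
  refine le_trans (le_of_eq ?_) (sum_sqrt_measureReal_singleton_le _ _ S)
  have hsingle : ∀ (δ : paramBody L) (x : (i : s) → Fin (L i)),
      (Measure.pi fun i : s => coordMeasure δ.1 i).real {x} = ∏ i : s, δ.1 i (x i) := by
    intro δ x
    rw [measureReal_def, Measure.pi_singleton, ENNReal.toReal_prod]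
    exact Finset.prod_congr rfl fun i _ => coordMeasure_real_singleton δ i (x i)
  rw [← Finset.prod_coe_sort s (fun j => ∑ l, √(β.1 j l * γ.1 j l)), Finset.prod_univ_sum,
    Fintype.piFinset_univ]
  refine Finset.sum_congr rfl fun x _ => ?_
  rw [hsingle, hsingle, ← Finset.prod_mul_distrib, Real.sqrt_prod]
  exact fun i _ => mul_nonneg (β.2.1 i (x i)).1 (γ.2.1 i (x i)).1

lemma affinity_nonneg_le_one (β γ : paramBody L) (j : ℕ) :
    0 ≤ ∑ l, √(β.1 j l * γ.1 j l) ∧ ∑ l, √(β.1 j l * γ.1 j l) ≤ 1 := by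
  refine ⟨Finset.sum_nonneg fun _ _ => Real.sqrt_nonneg _, ?_⟩
  have h := sum_sq_sqrt_sub_sqrt (fun l => (β.2.1 j l).1) (fun l => (γ.2.1 j l).1) (β.2.2 j)
    (γ.2.2 j)
  have : 0 ≤ ∑ l, (√(β.1 j l) - √(γ.1 j l)) ^ 2 := Finset.sum_nonneg fun _ _ => sq_nonneg _
  linarith

/-- The half of Kakutani's dichotomy which says that singular product measures have vanishing
Hellinger affinity: a set separating them is approximated by a cylinder. -/
lemma tendsto_prod_affinity_of_mutuallySingular {β γ : paramBody L}
    (h : indepMeasure β ⟂ₘ indepMeasure γ) :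
    Tendsto (fun n : ℕ => ∏ j ∈ Finset.range n, ∑ l, √(β.1 j l * γ.1 j l)) atTop (𝓝 0) := by
  obtain ⟨A, hA, hA1, hA2⟩ := h
  have hnn := fun j => (affinity_nonneg_le_one β γ j).1
  have hle := fun j => (affinity_nonneg_le_one β γ j).2
  have small : ∀ ε : ℝ, 0 < ε → ∃ s : Finset ℕ, ∏ j ∈ s, ∑ l, √(β.1 j l * γ.1 j l) < ε := by
    intro ε hε
    obtain ⟨t, ht, hlt⟩ := exists_measure_symmDiff_lt_of_generateFrom_isSetRing
      (μ := indepMeasure β + indepMeasure γ) (C := measurableCylinders fun j => Fin (L j))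
      isSetRing_measurableCylinders
      ⟨{Set.univ}, Set.countable_singleton _,
        Set.singleton_subset_iff.2 (univ_mem_measurableCylinders _), by simp⟩
      generateFrom_measurableCylinders.symm hA
      (ε := ENNReal.ofReal ((ε / 4) ^ 2)) (by positivity)
    rw [Measure.add_apply] at hlt
    obtain ⟨s, S, -, rfl⟩ := (mem_measurableCylinders t).1 ht
    refine ⟨s, (prod_affinity_le β γ s S).trans_lt ?_⟩
    have h1 : indepMeasure β (cylinder s S) ≤ ENNReal.ofReal ((ε / 4) ^ 2) := by
      calc indepMeasure β (cylinder s S)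
          ≤ indepMeasure β (symmDiff (cylinder s S) A ∪ A) := measure_mono fun x hx => by
            by_cases hxA : x ∈ A
            · exact Or.inr hxA
            · exact Or.inl (Or.inl ⟨hx, hxA⟩)
        _ ≤ indepMeasure β (symmDiff (cylinder s S) A) + indepMeasure β A := measure_union_le _ _
        _ ≤ _ := by rw [hA1, add_zero]; exact le_self_add.trans hlt.le
    have h2 : indepMeasure γ (cylinder s S)ᶜ ≤ ENNReal.ofReal ((ε / 4) ^ 2) := by
      calc indepMeasure γ (cylinder s S)ᶜ
          ≤ indepMeasure γ (symmDiff (cylinder s S) A ∪ Aᶜ) := measure_mono fun x hx => by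
            by_cases hxA : x ∈ A
            · exact Or.inl (Or.inr ⟨hxA, hx⟩)
            · exact Or.inr hxA
        _ ≤ indepMeasure γ (symmDiff (cylinder s S) A) + indepMeasure γ Aᶜ := measure_union_le _ _
        _ ≤ _ := by rw [hA2, add_zero]; exact le_add_self.trans hlt.le
    have h3 : √((indepMeasure β).real (cylinder s S)) ≤ ε / 4 :=
      Real.sqrt_le_iff.2 ⟨by positivity, ENNReal.toReal_le_of_le_ofReal (by positivity) h1⟩
    have h4 : √((indepMeasure γ).real (cylinder s S)ᶜ) ≤ ε / 4 :=
      Real.sqrt_le_iff.2 ⟨by positivity, ENNReal.toReal_le_of_le_ofReal (by positivity) h2⟩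
    linarith
  refine tendsto_order.2 ⟨fun a ha => Eventually.of_forall fun n =>
    ha.trans_le (Finset.prod_nonneg fun j _ => hnn j), fun a ha => ?_⟩
  obtain ⟨s, hs⟩ := small a ha
  filter_upwards [eventually_ge_atTop (s.sup id + 1)] with n hn
  have hsub : s ⊆ Finset.range n := fun j hj =>
    Finset.mem_range.2 ((Nat.lt_succ_of_le (Finset.le_sup (f := id) hj)).trans_le hn)
  exact (Finset.prod_le_prod_of_subset_of_le_one hsub (fun j _ => hnn j)
    fun j _ _ => hle j).trans_lt hs

end Affinity

/-! ### The product measures: moments and the zero-one law -/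

section ProductMeasure

variable {L : ℕ → ℕ}

lemma integral_coordMeasure (β : paramBody L) (j : ℕ) (ψ : Fin (L j) → ℝ) :
    ∫ l, ψ l ∂coordMeasure β.1 j = ∑ l, β.1 j l * ψ l := by
  rw [integral_fintype .of_finite]
  exact Finset.sum_congr rfl fun l _ => by rw [coordMeasure_real_singleton, smul_eq_mul]

lemma integral_indepMeasure_eval (β : paramBody L) (j : ℕ) (ψ : Fin (L j) → ℝ) :
    ∫ a, ψ (a j) ∂indepMeasure β = ∑ l, β.1 j l * ψ l := by
  rw [← integral_coordMeasure, indepMeasure,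
    ← (measurePreserving_eval_infinitePi (fun j => coordMeasure β.1 j) j).map_eq,
    integral_map (measurable_pi_apply j).aemeasurable
      (Measurable.of_discrete.aestronglyMeasurable)]

lemma memLp_indepMeasure_eval (β : paramBody L) (j : ℕ) (ψ : Fin (L j) → ℝ) (p : ENNReal) :
    MemLp (fun a : Outcomes L => ψ (a j)) p (indepMeasure β) := by
  obtain ⟨C, hC⟩ := (Set.finite_range fun l => ‖ψ l‖).bddAbove
  exact MemLp.of_bound
    (Measurable.of_discrete.comp (measurable_pi_apply j)).aestronglyMeasurable C
    (Eventually.of_forall fun a => hC ⟨a j, rfl⟩)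

/-- The variance of a sum of functions of the independent coordinates is at most the sum of their
second moments. -/
lemma integral_sq_sum_sub_mean_le (β : paramBody L) (s : Finset ℕ)
    (ψ : (j : ℕ) → Fin (L j) → ℝ) :
    ∫ a, (∑ j ∈ s, ψ j (a j) - ∑ j ∈ s, ∑ l, β.1 j l * ψ j l) ^ 2 ∂indepMeasure β ≤
      ∑ j ∈ s, ∑ l, β.1 j l * ψ j l ^ 2 := by
  set X : ℕ → Outcomes L → ℝ := fun j a => ψ j (a j) with hX
  have hmem : ∀ j, MemLp (X j) 2 (indepMeasure β) := fun j => memLp_indepMeasure_eval β j (ψ j) 2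
  have hind : iIndepFun X (indepMeasure β) :=
    iIndepFun_infinitePi (P := fun j => coordMeasure β.1 j) (X := ψ) fun j => .of_discrete
  have hmean : ∫ a, (∑ j ∈ s, X j) a ∂indepMeasure β = ∑ j ∈ s, ∑ l, β.1 j l * ψ j l := by
    simp only [Finset.sum_apply]
    rw [integral_finsetSum _ fun j _ => (hmem j).integrable one_le_two]
    exact Finset.sum_congr rfl fun j _ => integral_indepMeasure_eval β j (ψ j)
  have hvar : Var[∑ j ∈ s, X j; indepMeasure β] ≤ ∑ j ∈ s, ∑ l, β.1 j l * ψ j l ^ 2 := by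
    rw [IndepFun.variance_sum (fun j _ => hmem j) fun i _ j _ hij => hind.indepFun hij]
    refine Finset.sum_le_sum fun j _ =>
      (variance_le_expectation_sq (hmem j).aestronglyMeasurable).trans_eq ?_
    exact integral_indepMeasure_eval β j fun l => ψ j l ^ 2
  rw [variance_eq_integral
    (Finset.aemeasurable_sum _ fun j _ => (hmem j).aestronglyMeasurable.aemeasurable),
    hmean] at hvar
  simpa [X] using hvar

lemma tail_eq_limsup (L : ℕ → ℕ) :
    tail L = limsup (fun j => MeasurableSpace.comap (fun a : Outcomes L => a j) ⊤) atTop := by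
  rw [limsup_eq_iInf_iSup_of_nat]
  rfl

lemma tail_le (L : ℕ → ℕ) : tail L ≤ MeasurableSpace.pi :=
  (iInf_le _ 0).trans (sigmaX_le L _)

lemma sigmaX_univ (L : ℕ → ℕ) : sigmaX L Set.univ = MeasurableSpace.pi := by
  simp only [sigmaX, Set.mem_univ, iSup_pos]
  rfl

/-- By Kolmogorov's zero-one law the conditional probabilities given the tail σ-algebra are
constant. -/
lemma condExp_indicator_tail (β : paramBody L) {B : Set (Outcomes L)} (hB : MeasurableSet B) :
    (indepMeasure β)⟦B | tail L⟧ =ᵐ[indepMeasure β] fun _ => (indepMeasure β).real B := by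
  have hle : ∀ j, MeasurableSpace.comap (fun a : Outcomes L => a j) ⊤ ≤ MeasurableSpace.pi :=
    fun j => (measurable_pi_apply j).comap_le
  have hind : iIndep (fun j => MeasurableSpace.comap (fun a : Outcomes L => a j) ⊤)
      (indepMeasure β) :=
    iIndepFun_infinitePi (P := fun j => coordMeasure β.1 j) (X := fun j l => l)
      fun j => measurable_id
  have hI : Indep MeasurableSpace.pi (tail L) (indepMeasure β) := by
    rw [Indep_iff]
    intro s t hs ht
    rw [tail_eq_limsup] at ht
    rcases measure_zero_or_one_of_measurableSet_limsup_atTop hle hind ht with h | h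
    · rw [h, mul_zero]
      exact measure_mono_null Set.inter_subset_right h
    · rw [h, mul_one]
      exact measure_inter_conull ((prob_compl_eq_zero_iff₀
        ((tail_le L t (by rwa [tail_eq_limsup])).nullMeasurableSet)).2 h)
  have := condExp_indep_eq (m := MeasurableSpace.pi) (μ := indepMeasure β) le_rfl (tail_le L)
    ((stronglyMeasurable_const (b := (1 : ℝ))).indicator hB) hI
  simpa [integral_indicator_const _ hB] using this

end ProductMeasure
/-! ### The information form -/

section Information

variable {L : ℕ → ℕ} {K : ℕ} {lam : Fin K → BetaSpace L}

/-- The vector `∑ₖ λᵏ`, a multiple of the barycentre of the `λᵏ`. It dominates every `β(g)`. -/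
noncomputable def baseVec (lam : Fin K → BetaSpace L) : BetaSpace L := ∑ k, lam k

lemma baseVec_apply (j : ℕ) (l : Fin (L j)) : baseVec lam j l = ∑ k, lam k j l := by
  simp [baseVec, Finset.sum_apply]

lemma baseVec_nonneg (hmem : ∀ k, lam k ∈ paramBody L) (j : ℕ) (l : Fin (L j)) :
    0 ≤ baseVec lam j l := by
  rw [baseVec_apply]
  exact Finset.sum_nonneg fun k _ => ((hmem k).1 j l).1

lemma abs_betaMap_le (hmem : ∀ k, lam k ∈ paramBody L) (g : EuclideanSpace ℝ (Fin K)) (j : ℕ)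
    (l : Fin (L j)) : |betaMap lam g j l| ≤ ‖g‖ * baseVec lam j l := by
  rw [betaMap_apply, baseVec_apply, Finset.mul_sum]
  refine (Finset.abs_sum_le_sum_abs _ _).trans (Finset.sum_le_sum fun k _ => ?_)
  rw [abs_mul, abs_of_nonneg ((hmem k).1 j l).1]
  exact mul_le_mul_of_nonneg_right (by simpa using PiLp.norm_apply_le g k) ((hmem k).1 j l).1

lemma betaMap_eq_zero_of_baseVec_eq_zero (hmem : ∀ k, lam k ∈ paramBody L)
    (g : EuclideanSpace ℝ (Fin K)) {j : ℕ} {l : Fin (L j)} (h : baseVec lam j l = 0) :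
    betaMap lam g j l = 0 := by
  simpa [h] using abs_betaMap_le hmem g j l

lemma sum_betaMap (hmem : ∀ k, lam k ∈ paramBody L) (g : EuclideanSpace ℝ (Fin K)) (j : ℕ) :
    ∑ l, betaMap lam g j l = ∑ k, g k := by
  simp only [betaMap_apply]
  rw [Finset.sum_comm]
  simp [← Finset.mul_sum, (hmem _).2 j]

lemma sum_baseVec (hmem : ∀ k, lam k ∈ paramBody L) (j : ℕ) : ∑ l, baseVec lam j l = K := by
  simp only [baseVec_apply]
  rw [Finset.sum_comm]
  simp [(hmem _).2 j]

/-- The Fisher information form of the coordinates `X_j`, `j ∈ s`, at the barycentre of the `λᵏ`, up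
to the factor `K`. Terms with a vanishing denominator have a vanishing numerator and count as
`0`. -/
noncomputable def info (lam : Fin K → BetaSpace L) (s : Finset ℕ)
    (v w : EuclideanSpace ℝ (Fin K)) : ℝ :=
  ∑ j ∈ s, ∑ l, betaMap lam v j l * betaMap lam w j l / baseVec lam j l

lemma info_self_nonneg (hmem : ∀ k, lam k ∈ paramBody L) (s : Finset ℕ)
    (v : EuclideanSpace ℝ (Fin K)) : 0 ≤ info lam s v v :=
  Finset.sum_nonneg fun j _ => Finset.sum_nonneg fun l _ =>
    div_nonneg (mul_self_nonneg _) (baseVec_nonneg hmem j l)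

lemma info_smul_smul (s : Finset ℕ) (c : ℝ) (v : EuclideanSpace ℝ (Fin K)) :
    info lam s (c • v) (c • v) = c ^ 2 * info lam s v v := by
  simp only [info, Finset.mul_sum, betaMap_smul, Pi.smul_apply, smul_eq_mul]
  refine Finset.sum_congr rfl fun j _ => Finset.sum_congr rfl fun l _ => ?_
  ring

/-- `info` as a linear map into the dual space. -/
noncomputable def infoLin (lam : Fin K → BetaSpace L) (s : Finset ℕ) :
    EuclideanSpace ℝ (Fin K) →ₗ[ℝ] Module.Dual ℝ (EuclideanSpace ℝ (Fin K)) :=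
  LinearMap.mk₂ ℝ (info lam s)
    (fun v₁ v₂ w => by
      simp only [info, betaMap_add, Pi.add_apply, add_mul, add_div, Finset.sum_add_distrib])
    (fun c v w => by
      simp only [info, betaMap_smul, Pi.smul_apply, smul_eq_mul, Finset.mul_sum, mul_assoc,
        mul_div_assoc])
    (fun v w₁ w₂ => by
      simp only [info, betaMap_add, Pi.add_apply, mul_add, add_div, Finset.sum_add_distrib])
    (fun c v w => by
      simp only [info, betaMap_smul, Pi.smul_apply, smul_eq_mul, Finset.mul_sum, mul_div_assoc,
        mul_left_comm])

/-- Cauchy–Schwarz: in a direction along which total mass changes every coordinate carries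
information. -/
lemma sq_sum_le_mul_info (hmem : ∀ k, lam k ∈ paramBody L) (v : EuclideanSpace ℝ (Fin K)) (j : ℕ) :
    (∑ k, v k) ^ 2 ≤ (∑ l, betaMap lam v j l * betaMap lam v j l / baseVec lam j l) * K := by
  rw [← sum_betaMap hmem v j, ← sum_baseVec hmem j]
  refine Finset.sum_sq_le_sum_mul_sum_of_sq_le_mul _
    (fun l _ => div_nonneg (mul_self_nonneg _) (baseVec_nonneg hmem j l))
    (fun l _ => baseVec_nonneg hmem j l) fun l _ => ?_
  by_cases h : baseVec lam j l = 0
  · simp [h, betaMap_eq_zero_of_baseVec_eq_zero hmem v h]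
  · rw [div_mul_cancel₀ _ h, sq]

/-- If all Hellinger distances between points of `Q` are infinite, then the information in every
direction is infinite: a direction `v` with `∑ₖ vₖ = 0` is spanned by two points of `Q` symmetric
about the barycentre. -/
lemma tendsto_info_atTop (hmem : ∀ k, lam k ∈ paramBody L)
    (h : ∀ g' g'' : paramSet lam, g' ≠ g'' →
      Tendsto (fun n : ℕ => ∑ j ∈ Finset.range n, ∑ l,
        (√(betaMap lam g'.1 j l) - √(betaMap lam g''.1 j l)) ^ 2) atTop atTop)
    {v : EuclideanSpace ℝ (Fin K)} (hv : v ≠ 0) :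
    Tendsto (fun n => info lam (Finset.range n) v v) atTop atTop := by
  have hK : 0 < K := by
    rcases Nat.eq_zero_or_pos K with rfl | hK
    · exact absurd (Subsingleton.elim _ _) hv
    · exact hK
  have hK' : (0 : ℝ) < K := Nat.cast_pos.2 hK
  by_cases hs : ∑ k, v k = 0
  swap
  · have hs2 : 0 < (∑ k, v k) ^ 2 / K := div_pos (by positivity) hK'
    refine tendsto_atTop_mono (fun n => ?_) (tendsto_natCast_atTop_atTop.atTop_mul_const hs2)
    rw [info, ← nsmul_eq_mul, ← Finset.card_range n, ← Finset.sum_const, Finset.card_range]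
    exact Finset.sum_le_sum fun j _ => (div_le_iff₀ hK').2 (sq_sum_le_mul_info hmem v j)
  -- the step from the barycentre stays in the simplex spanned by the unit vectors
  set ε : ℝ := 1 / (K * (‖v‖ + 1)) with hε
  have hε0 : 0 < ε := by positivity
  have hεv : ∀ k, |ε * v k| ≤ 1 / K := by
    intro k
    have h1 : |v k| ≤ ‖v‖ := by simpa using PiLp.norm_apply_le v k
    rw [abs_mul, abs_of_pos hε0, hε, div_mul_eq_mul_div, one_mul,
      div_le_div_iff₀ (by positivity) hK']
    nlinarith
  set c : EuclideanSpace ℝ (Fin K) := WithLp.toLp 2 fun _ => (1 / K : ℝ) with hc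
  have hcβ : ∀ j l, betaMap lam c j l = baseVec lam j l / K := by
    intro j l
    rw [betaMap_apply, baseVec_apply, div_eq_inv_mul, Finset.mul_sum]
    simp [hc]
  have hcsum : ∑ k, c k = 1 := by simp [hc, hK'.ne']
  have hp : c + ε • v ∈ paramSet lam := by
    refine mem_paramSet_of_nonneg_of_sum_eq_one hmem (fun k => ?_) ?_
    · have := neg_abs_le (ε * v k)
      have h2 := hεv k
      simp only [hc, PiLp.add_apply, PiLp.smul_apply, smul_eq_mul]
      linarith
    · simp only [PiLp.add_apply, PiLp.smul_apply, smul_eq_mul, Finset.sum_add_distrib, hcsum,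
        ← Finset.mul_sum, hs, mul_zero, add_zero]
  have hm : c - ε • v ∈ paramSet lam := by
    refine mem_paramSet_of_nonneg_of_sum_eq_one hmem (fun k => ?_) ?_
    · have := le_abs_self (ε * v k)
      have h2 := hεv k
      simp only [hc, PiLp.sub_apply, PiLp.smul_apply, smul_eq_mul]
      linarith
    · simp only [PiLp.sub_apply, PiLp.smul_apply, smul_eq_mul, Finset.sum_sub_distrib, hcsum,
        ← Finset.mul_sum, hs, mul_zero, sub_zero]
  have hne : (⟨_, hp⟩ : paramSet lam) ≠ ⟨_, hm⟩ := by
    intro heq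
    have h1 : c + ε • v = c - ε • v := congrArg Subtype.val heq
    have h2 : (2 * ε) • v = 0 := by
      have : (2 * ε) • v = (c + ε • v) - (c - ε • v) := by module
      rw [this, h1, sub_self]
    rcases smul_eq_zero.1 h2 with h3 | h3
    · exact absurd h3 (by positivity)
    · exact hv h3
  have hdiv := h _ _ hne
  have hC : (0 : ℝ) < 2 * ε ^ 2 * K := by positivity
  rw [← tendsto_const_mul_atTop_of_pos hC]
  refine tendsto_atTop_mono (fun n => ?_) hdiv
  rw [info, Finset.mul_sum]
  refine Finset.sum_le_sum fun j _ => ?_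
  rw [Finset.mul_sum]
  refine Finset.sum_le_sum fun l _ => ?_
  have key := sq_sqrt_sub_sqrt_mul_add_le (hp.1 j l).1 (hm.1 j l).1
  simp only [betaMap_add, betaMap_sub, betaMap_smul, Pi.add_apply, Pi.sub_apply, Pi.smul_apply,
    smul_eq_mul, hcβ] at key ⊢
  rcases (baseVec_nonneg hmem j l).eq_or_lt with h0 | h0
  · simp [← h0, betaMap_eq_zero_of_baseVec_eq_zero hmem v h0.symm]
  · have h1 : 0 < 2 * baseVec lam j l / K := by positivity
    refine le_of_mul_le_mul_right ?_ h1
    refine le_trans (le_of_eq ?_) (key.trans_eq ?_)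
    · congr 1; ring
    · field_simp; ring

/-- Divergence in every direction is uniform in the direction, by compactness of the sphere. -/
lemma exists_mul_sq_norm_le_info (hmem : ∀ k, lam k ∈ paramBody L)
    (h : ∀ v : EuclideanSpace ℝ (Fin K), v ≠ 0 →
      Tendsto (fun n => info lam (Finset.range n) v v) atTop atTop) (m : ℕ) (M : ℝ) :
    ∃ n, ∀ v, M * ‖v‖ ^ 2 ≤ info lam (Finset.Ico m n) v v := by
  have hcont : ∀ s, Continuous fun v : EuclideanSpace ℝ (Fin K) => info lam s v v := by
    intro s
    unfold info
    have hβ : ∀ j l, Continuous fun v : EuclideanSpace ℝ (Fin K) => betaMap lam v j l := fun j l =>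
      (continuous_apply l).comp ((continuous_apply j).comp (continuous_betaMap lam))
    exact continuous_finsetSum _ fun j _ => continuous_finsetSum _ fun l _ =>
      ((hβ j l).mul (hβ j l)).div_const _
  have hmono : ∀ v, Monotone fun n => info lam (Finset.Ico m n) v v := by
    intro v n₁ n₂ hn
    exact Finset.sum_le_sum_of_subset_of_nonneg (Finset.Ico_subset_Ico_right hn) fun j _ _ =>
      Finset.sum_nonneg fun l _ => div_nonneg (mul_self_nonneg _) (baseVec_nonneg hmem j l)
  obtain ⟨n, hn⟩ := (isCompact_sphere (0 : EuclideanSpace ℝ (Fin K)) 1).elim_directed_cover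
    (fun n => {v | M < info lam (Finset.Ico m n) v v})
    (fun n => isOpen_lt continuous_const (hcont _))
    (fun v hv => by
      have hv0 : v ≠ 0 := by
        rintro rfl
        simp at hv
      have ht := tendsto_atTop_add_const_right atTop (-info lam (Finset.range m) v v) (h v hv0)
      obtain ⟨n, hn, hmn⟩ := ((ht.eventually_gt_atTop M).and (eventually_ge_atTop m)).exists
      refine Set.mem_iUnion.2 ⟨n, ?_⟩
      simp only [Set.mem_ofPred_eq, info, Finset.sum_Ico_eq_sub _ hmn]
      simpa [info, sub_eq_add_neg] using hn)
    (directed_of_isDirected_le fun n₁ n₂ hn v hv => lt_of_lt_of_le hv (hmono v hn))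
  refine ⟨n, fun v => ?_⟩
  by_cases hv : v = 0
  · simpa [hv] using info_self_nonneg hmem _ (0 : EuclideanSpace ℝ (Fin K))
  · have hv' : 0 < ‖v‖ := norm_pos_iff.2 hv
    have h1 : ‖v‖⁻¹ • v ∈ Metric.sphere (0 : EuclideanSpace ℝ (Fin K)) 1 := by
      simp [norm_smul, hv'.ne']
    have h2 : M < info lam (Finset.Ico m n) (‖v‖⁻¹ • v) (‖v‖⁻¹ • v) := hn h1
    rw [info_smul_smul, inv_pow, ← div_eq_inv_mul, lt_div_iff₀ (by positivity)] at h2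
    exact h2.le

end Information

/-! ### A consistent estimator -/

section Estimator

variable {L : ℕ → ℕ} {K : ℕ} {lam : Fin K → BetaSpace L}

/-- Weighted least squares: if the information form of a block of coordinates is at least `M`, then
each coordinate of `g` has a linear estimator based on this block with mean square error at most
`‖g‖ / M`. -/
lemma exists_linear_estimator (hmem : ∀ k, lam k ∈ paramBody L) {s : Finset ℕ} {M : ℝ}
    (hM : 0 < M) (hs : ∀ v, M * ‖v‖ ^ 2 ≤ info lam s v v) (i : Fin K) :
    ∃ ψ : (j : ℕ) → Fin (L j) → ℝ, ∀ g : paramSet lam,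
      ∫ a, (∑ j ∈ s, ψ j (a j) - g.1 i) ^ 2 ∂family lam g ≤ ‖g.1‖ / M := by
  have hinj : Function.Injective (infoLin lam s) := by
    rw [← LinearMap.ker_eq_bot, LinearMap.ker_eq_bot']
    intro v hv
    have h0 : info lam s v v = 0 := congrArg (fun φ => φ v) hv
    have h1 := hs v
    rw [h0] at h1
    by_contra hne
    have : 0 < M * ‖v‖ ^ 2 := mul_pos hM (pow_pos (norm_pos_iff.2 hne) 2)
    linarith
  have hsurj := (LinearMap.injective_iff_surjective_of_finrank_eq_finrank
    (Subspace.dual_finrank_eq (K := ℝ) (V := EuclideanSpace ℝ (Fin K))).symm).1 hinj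
  -- `w` represents the `i`-th coordinate functional in the information form
  obtain ⟨w, hw⟩ := hsurj (EuclideanSpace.proj (𝕜 := ℝ) i).toLinearMap
  have hw' : ∀ v, info lam s w v = v i := fun v => congrArg (fun φ => φ v) hw
  have hwi : w i ≤ 1 / M := by
    have h1 := hs w
    rw [hw' w] at h1
    have h2 : |w i| ≤ ‖w‖ := by simpa using PiLp.norm_apply_le w i
    have h3 := le_abs_self (w i)
    rw [le_div_iff₀ hM]
    rcases (norm_nonneg w).eq_or_lt with h | h
    · rw [← h] at h2
      nlinarith
    · have h4 : M * ‖w‖ ≤ 1 := by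
        refine le_of_mul_le_mul_right ?_ h
        nlinarith
      nlinarith
  refine ⟨fun j l => betaMap lam w j l / baseVec lam j l, fun g => ?_⟩
  have hmean : ∑ j ∈ s, ∑ l, betaMap lam g.1 j l * (betaMap lam w j l / baseVec lam j l) =
      g.1 i := by
    rw [← hw' g.1, info]
    refine Finset.sum_congr rfl fun j _ => Finset.sum_congr rfl fun l _ => ?_
    ring
  have hvar : ∑ j ∈ s, ∑ l, betaMap lam g.1 j l * (betaMap lam w j l / baseVec lam j l) ^ 2 ≤
      ‖g.1‖ * info lam s w w := by
    rw [info, Finset.mul_sum]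
    refine Finset.sum_le_sum fun j _ => ?_
    rw [Finset.mul_sum]
    refine Finset.sum_le_sum fun l _ => ?_
    have h1 := (le_abs_self _).trans (abs_betaMap_le hmem g.1 j l)
    refine (mul_le_mul_of_nonneg_right h1 (sq_nonneg _)).trans_eq ?_
    by_cases h0 : baseVec lam j l = 0
    · simp [h0]
    · field_simp
  have := integral_sq_sum_sub_mean_le (betaBody lam g) s
    fun j l => betaMap lam w j l / baseVec lam j l
  simp only [betaBody, hmean] at this
  refine this.trans (hvar.trans ?_)
  rw [hw' w, div_eq_mul_one_div]
  exact mul_le_mul_of_nonneg_left hwi (norm_nonneg _)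

/-- A sequence whose second moments decrease geometrically converges to zero almost surely. -/
lemma ae_tendsto_zero_of_integral_sq_le {Ω : Type*} [MeasurableSpace Ω] {P : Measure Ω}
    {f : ℕ → Ω → ℝ} (hf : ∀ k, MemLp (f k) 2 P) {C : ℝ} (hC : 0 ≤ C)
    (h : ∀ k, ∫ a, f k a ^ 2 ∂P ≤ C * (1 / 2) ^ k) :
    ∀ᵐ a ∂P, Tendsto (fun k => f k a) atTop (𝓝 0) := by
  have hm : ∀ k, AEMeasurable (fun a => ENNReal.ofReal (f k a ^ 2)) P := fun k =>
    ((hf k).aestronglyMeasurable.aemeasurable.pow_const 2).ennreal_ofReal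
  have hsum : ∫⁻ a, ∑' k, ENNReal.ofReal (f k a ^ 2) ∂P ≠ ⊤ := by
    rw [lintegral_tsum hm]
    refine ne_top_of_le_ne_top (b := ∑' k, ENNReal.ofReal (C * (1 / 2) ^ k)) ?_
      (ENNReal.tsum_le_tsum fun k => ?_)
    · have hs : Summable fun k : ℕ => C * (1 / 2 : ℝ) ^ k := summable_geometric_two.mul_left C
      rw [← ENNReal.ofReal_tsum_of_nonneg (fun k => by positivity) hs]
      exact ENNReal.ofReal_ne_top
    · rw [← ofReal_integral_eq_lintegral_ofReal (hf k).integrable_sq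
        (Eventually.of_forall fun a => sq_nonneg _)]
      exact ENNReal.ofReal_le_ofReal (h k)
  filter_upwards [ae_lt_top' (AEMeasurable.tsum hm) hsum] with a ha
  have h1 := ENNReal.tendsto_atTop_zero_of_tsum_ne_top ha.ne
  have h2 := (ENNReal.tendsto_toReal ENNReal.zero_ne_top).comp h1
  have h3 : Tendsto (fun k => f k a ^ 2) atTop (𝓝 0) := by
    refine h2.congr fun k => ?_
    simp [ENNReal.toReal_ofReal (sq_nonneg (f k a))]
  have h4 := h3.sqrt
  simp only [Real.sqrt_sq_eq_abs, Real.sqrt_zero] at h4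
  exact (tendsto_zero_iff_abs_tendsto_zero _).2 h4

lemma measurable_sum_eval_sigmaX {S : Set ℕ} {s : Finset ℕ} (hs : ∀ j ∈ s, j ∈ S)
    (ψ : (j : ℕ) → Fin (L j) → ℝ) :
    Measurable[sigmaX L S] fun a : Outcomes L => ∑ j ∈ s, ψ j (a j) := by
  refine @Finset.measurable_sum _ _ _ _ _ _ (sigmaX L S) _ _ fun j hj => ?_
  have hj' : Measurable[sigmaX L S] fun a : Outcomes L => a j :=
    Measurable.mono (comap_measurable _) (le_iSup₂ (f := fun j (_ : j ∈ S) =>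
      MeasurableSpace.comap (fun a : Outcomes L => a j) ⊤) j (hs j hj)) le_rfl
  exact Measurable.comp .of_discrete hj'

lemma exists_measurable_codRestrict {X E : Type*} [mX : MeasurableSpace X] [MeasurableSpace E]
    {s : Set E} [Nonempty s] (hs : MeasurableSet s) {f : X → E} (hf : Measurable f) :
    ∃ f' : X → s, Measurable f' ∧ ∀ x, f x ∈ s → (f' x : E) = f x := by
  classical
  obtain ⟨y⟩ := ‹Nonempty s›
  refine ⟨fun x => if hx : f x ∈ s then ⟨f x, hx⟩ else y, ?_, fun x hx => by simp [hx]⟩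
  exact Measurable.dite (f := fun x => ⟨f x, x.2⟩) (g := fun _ => y)
    (hf.comp measurable_subtype_coe).subtype_mk measurable_const (hf hs)

/-- If the information is infinite in every direction, then `g` is `P_g`-almost surely a fixed
function of the sequence of outcomes, which even is measurable with respect to the tail σ-algebra:
the limit of estimators based on blocks of coordinates which move to infinity. -/
lemma exists_tail_estimator (hmem : ∀ k, lam k ∈ paramBody L)
    (h : ∀ v : EuclideanSpace ℝ (Fin K), v ≠ 0 →
      Tendsto (fun n => info lam (Finset.range n) v v) atTop atTop) [Nonempty (paramSet lam)] :
    ∃ f : Outcomes L → paramSet lam, Measurable[tail L] f ∧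
      ∀ g : paramSet lam, ∀ᵐ a ∂family lam g, f a = g := by
  choose n hn using fun k : ℕ => exists_mul_sq_norm_le_info hmem h k (2 ^ k)
  choose ψ hψ using fun (k : ℕ) (i : Fin K) =>
    exists_linear_estimator hmem (pow_pos (two_pos (α := ℝ)) k) (hn k) i
  set T : ℕ → Fin K → Outcomes L → ℝ := fun k i a => ∑ j ∈ Finset.Ico k (n k), ψ k i j (a j) with hT
  have hTlim : ∀ (g : paramSet lam) i, ∀ᵐ a ∂family lam g,
      Tendsto (fun k => T k i a) atTop (𝓝 (g.1 i)) := by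
    intro g i
    have := ae_tendsto_zero_of_integral_sq_le (P := family lam g) (f := fun k a => T k i a - g.1 i)
      (C := ‖g.1‖) (fun k => ?_) (norm_nonneg _) fun k => ?_
    · filter_upwards [this] with a ha
      simpa using ha.add_const (g.1 i)
    · exact (memLp_finsetSum _ fun j _ =>
        memLp_indepMeasure_eval (betaBody lam g) j (ψ k i j) 2).sub (memLp_const _)
    · exact (hψ k i g).trans_eq (by rw [one_div, inv_pow, div_eq_mul_inv])
  set f : Outcomes L → EuclideanSpace ℝ (Fin K) := fun a =>
    WithLp.toLp 2 fun i => limsup (fun k => T k i a) atTop with hf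
  have hfm : Measurable[tail L] f := by
    have hcoord : ∀ i, Measurable[tail L] fun a => limsup (fun k => T k i a) atTop := by
      intro i B hB
      refine MeasurableSpace.measurableSet_iInf.2 fun m => ?_
      -- dropping the first `m` estimators leaves only functions of the coordinates `j ≥ m`
      have hshift : (fun a => limsup (fun k => T k i a) atTop) =
          fun a => limsup (fun k => T (k + m) i a) atTop :=
        funext fun a => (limsup_nat_add (fun k => T k i a) m).symm
      rw [hshift]
      refine Measurable.limsup (mδ := sigmaX L {j | m ≤ j}) (fun k => ?_) hB
      exact measurable_sum_eval_sigmaX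
        (fun j hj => (Nat.le_add_left m k).trans (Finset.mem_Ico.1 hj).1) _
    exact (WithLp.measurable_toLp 2 _).comp (@measurable_pi_lambda _ _ _ (tail L) _ _ hcoord)
  obtain ⟨f', hf'm, hf'⟩ := exists_measurable_codRestrict (mX := tail L)
    (measurableSet_paramSet lam) hfm
  refine ⟨f', hf'm, fun g => ?_⟩
  filter_upwards [ae_all_iff.2 (hTlim g)] with a ha
  have hfa : f a = g.1 := by
    ext i
    exact (ha i).limsup_eq
  exact Subtype.ext ((hf' a (hfa ▸ g.2)).trans hfa)

end Estimator
/-! ### The Bayesian model -/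

section Bayes

variable {L : ℕ → ℕ} {K : ℕ} {lam : Fin K → BetaSpace L} (μ : ProbabilityMeasure (paramSet lam))

instance nu_isProbabilityMeasure : IsProbabilityMeasure (nu μ) := by
  unfold nu; infer_instance

lemma map_fst_nu : (nu μ).map Prod.fst = μ := Measure.fst_compProd _ _

lemma map_snd_nu : (nu μ).map Prod.snd = (mixture μ : Measure (Outcomes L)) :=
  Measure.snd_compProd _ _

variable {μ}

/-- A property which holds `ν[μ]`-almost surely holds `P_g`-almost surely for every atom `g`
of `μ`. -/
lemma ae_family_of_ae_nu {p : Omega lam → Prop} (h : ∀ᵐ ω ∂nu μ, p ω) {g : paramSet lam}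
    (hg : (μ : Measure (paramSet lam)) {g} ≠ 0) : ∀ᵐ a ∂family lam g, p (g, a) := by
  by_contra hn
  exact hg (measure_mono_null (Set.singleton_subset_iff.2 hn) (Measure.ae_ae_of_ae_compProd h))

lemma ae_nu_of_forall_ae_family {p : Omega lam → Prop} (hp : MeasurableSet {ω | p ω})
    (h : ∀ g, ∀ᵐ a ∂family lam g, p (g, a)) : ∀ᵐ ω ∂nu μ, p ω :=
  (Measure.ae_compProd_iff hp).2 (Eventually.of_forall h)

lemma measurable_G : Measurable (G lam) := measurable_subtype_coe.comp measurable_fst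

lemma memLp_G (hlin : LinearIndependent ℝ lam) (p : ENNReal) : MemLp (G lam) p (nu μ) := by
  obtain ⟨C, hC⟩ := (isCompact_paramSet hlin).isBounded.exists_norm_le
  exact MemLp.of_bound measurable_G.aestronglyMeasurable C
    (Eventually.of_forall fun ω => hC _ ω.1.2)

lemma integrable_G (hlin : LinearIndependent ℝ lam) : Integrable (G lam) (nu μ) :=
  memLp_one_iff_integrable.1 (memLp_G hlin 1)

/-- The conditional mean of `G` takes values in the closed convex set `Q`, so that the maps `eₙ` and
`e_∞` almost surely are the conditional means. -/
lemma condMean_ae_eq (hlin : LinearIndependent ℝ lam) (S : Set ℕ) :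
    ∀ᵐ ω ∂nu μ, ((condMean μ S ω.2 : paramSet lam) : EuclideanSpace ℝ (Fin K)) =
      ((nu μ)[G lam | sigmaOmega lam S]) ω := by
  filter_upwards [(convex_paramSet lam).condExp_mem (sigmaOmega_le lam S)
    (integrable_G (μ := μ) hlin) (isClosed_paramSet lam)
    (Eventually.of_forall fun ω => ω.1.2)] with ω hω
  rw [← condExp_eq_of_fst μ S (basePoint μ) ω.1 ω.2] at hω
  rw [condMean, dif_pos hω]
  exact condExp_eq_of_fst μ S _ _ _

lemma FInf_eq_comap : FInf lam = MeasurableSpace.pi.comap Prod.snd := by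
  rw [FInf, sigmaOmega, sigmaX_univ]

lemma measurable_comp_snd_FInf {E : Type*} [MeasurableSpace E] {f : Outcomes L → E}
    (hf : Measurable f) : Measurable[FInf lam] fun ω : Omega lam => f ω.2 := by
  rw [FInf_eq_comap]
  exact hf.comp (comap_measurable _)

lemma FInf_le : FInf lam ≤ Prod.instMeasurableSpace := sigmaOmega_le lam _

/-- The filtration generated by the outcomes. -/
def outcomeFiltration (lam : Fin K → BetaSpace L) :
    Filtration ℕ (Prod.instMeasurableSpace : MeasurableSpace (Omega lam)) where
  seq := F lam
  mono' _ _ hmn := MeasurableSpace.comap_mono <|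
    biSup_mono fun _ hj => lt_of_lt_of_le hj hmn
  le' _ := sigmaOmega_le lam _

lemma iSup_F : ⨆ n, F lam n = FInf lam := by
  have h : ⨆ n : ℕ, sigmaX L {j | j < n} = sigmaX L Set.univ := by
    refine le_antisymm (iSup_le fun n => iSup₂_le fun j _ => ?_) (iSup₂_le fun j _ => ?_)
    · exact le_iSup₂_of_le j (Set.mem_univ j) le_rfl
    · exact le_iSup_of_le (j + 1) (le_iSup₂_of_le j (Nat.lt_succ_self j) le_rfl)
  exact (MeasurableSpace.comap_iSup.symm).trans (congrArg (MeasurableSpace.comap Prod.snd) h)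

lemma condExp_G_apply_ae_eq (hlin : LinearIndependent ℝ lam) (m : MeasurableSpace (Omega lam))
    (k : Fin K) :
    (fun ω => ((nu μ)[G lam | m]) ω k) =ᵐ[nu μ] (nu μ)[fun ω => G lam ω k | m] :=
  (ContinuousLinearMap.comp_condExp_comm (m := m) (integrable_G (μ := μ) hlin)
    (EuclideanSpace.proj (𝕜 := ℝ) k))

/-- Lévy's upward theorem for the maps `eₙ`. -/
lemma ae_tendsto_e (hlin : LinearIndependent ℝ lam) :
    ∀ᵐ ω ∂nu μ, Tendsto (fun n => e μ n ω.2) atTop (𝓝 (eInf μ ω.2)) := by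
  have h1 := fun k => tendsto_ae_condExp (μ := nu μ) (ℱ := outcomeFiltration lam)
    fun ω => G lam ω k
  have hsup : ⨆ n, outcomeFiltration lam n = FInf lam := iSup_F
  simp only [hsup] at h1
  filter_upwards [ae_all_iff.2 h1, condMean_ae_eq (μ := μ) hlin Set.univ,
    ae_all_iff.2 fun n : ℕ => condMean_ae_eq (μ := μ) hlin {j | j < n},
    ae_all_iff.2 fun k => condExp_G_apply_ae_eq (μ := μ) hlin (FInf lam) k,
    ae_all_iff.2 fun n => ae_all_iff.2 fun k =>
      condExp_G_apply_ae_eq (μ := μ) hlin (F lam n) k] with ω hω h2 h3 h4 h5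
  rw [tendsto_subtype_rng]
  have h6 : Tendsto (fun n => WithLp.ofLp ((e μ n ω.2 : paramSet lam) : EuclideanSpace ℝ (Fin K)))
      atTop (𝓝 (WithLp.ofLp ((eInf μ ω.2 : paramSet lam) : EuclideanSpace ℝ (Fin K)))) := by
    refine tendsto_pi_nhds.2 fun k => ?_
    have h7 : ∀ n, ((e μ n ω.2 : paramSet lam) : EuclideanSpace ℝ (Fin K)) k =
        ((nu μ)[fun ω => G lam ω k | outcomeFiltration lam n]) ω := fun n =>
      (congrArg (fun x : EuclideanSpace ℝ (Fin K) => x k) (h3 n)).trans (h5 n k)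
    have h8 : ((eInf μ ω.2 : paramSet lam) : EuclideanSpace ℝ (Fin K)) k =
        ((nu μ)[fun ω => G lam ω k | FInf lam]) ω :=
      (congrArg (fun x : EuclideanSpace ℝ (Fin K) => x k) h2).trans (h4 k)
    rw [h8]
    exact (hω k).congr fun n => (h7 n).symm
  exact ((PiLp.continuous_toLp 2 _).tendsto _).comp h6

lemma map_condMean_eq (S : Set ℕ) :
    ((mixture μ : Measure (Outcomes L)).map (condMean μ S)) =
      (nu μ).map fun ω => condMean μ S ω.2 := by
  rw [← map_snd_nu, Measure.map_map (measurable_condMean μ S) measurable_snd]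
  rfl

lemma tendsto_muHat (hlin : LinearIndependent ℝ lam) :
    Tendsto (fun n => muHat μ n) atTop (𝓝 (muHatInf μ)) := by
  rw [ProbabilityMeasure.tendsto_iff_forall_integral_tendsto]
  intro f
  have hint : ∀ S, ∫ g, f g ∂((mixture μ : Measure (Outcomes L)).map (condMean μ S)) =
      ∫ ω, f (condMean μ S ω.2) ∂nu μ := by
    intro S
    have hm : Measurable fun ω : Omega lam => condMean μ S ω.2 :=
      (measurable_condMean μ S).comp measurable_snd
    rw [map_condMean_eq, integral_map hm.aemeasurable f.continuous.aestronglyMeasurable]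
  simp only [muHat, muHatInf, ProbabilityMeasure.toMeasure_map, e, eInf, hint]
  refine tendsto_integral_of_dominated_convergence (fun _ => ‖f‖) (fun n => ?_)
    (integrable_const _) (fun n => Eventually.of_forall fun ω => f.norm_coe_le_norm _) ?_
  · exact (f.continuous.measurable.comp
      ((measurable_condMean μ _).comp measurable_snd)).aestronglyMeasurable
  · filter_upwards [ae_tendsto_e (μ := μ) hlin] with ω hω
    exact (f.continuous.tendsto _).comp hω

/-! ### Conditions on a single prior -/

lemma G_ae_eq_condExp_of_ae_eq (hlin : LinearIndependent ℝ lam) {f : Omega lam → paramSet lam}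
    (hf : Measurable[FInf lam] f) (h : ∀ᵐ ω ∂nu μ, ω.1 = f ω) :
    G lam =ᵐ[nu μ] (nu μ)[G lam | FInf lam] := by
  refine (condExp_of_aestronglyMeasurable' FInf_le ?_ (integrable_G hlin)).symm
  refine ⟨fun ω => (f ω : EuclideanSpace ℝ (Fin K)),
    (measurable_subtype_coe.comp hf).stronglyMeasurable, ?_⟩
  filter_upwards [h] with ω hω
  exact congrArg Subtype.val hω

lemma fst_ae_eq_eInf_of_G_ae_eq (hlin : LinearIndependent ℝ lam)
    (h : G lam =ᵐ[nu μ] (nu μ)[G lam | FInf lam]) : ∀ᵐ ω ∂nu μ, ω.1 = eInf μ ω.2 := by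
  filter_upwards [h, condMean_ae_eq (μ := μ) hlin Set.univ] with ω h1 h2
  exact Subtype.ext (h1.trans h2.symm)

lemma nu_eq_one_iff : nu μ {ω | ω.1 = eInf μ ω.2} = 1 ↔ ∀ᵐ ω ∂nu μ, ω.1 = eInf μ ω.2 :=
  (mem_ae_iff_prob_eq_one (measurableSet_eq_fun measurable_fst
    ((measurable_condMean μ _).comp measurable_snd))).symm

lemma muHatInf_eq_of_ae_eq (h : ∀ᵐ ω ∂nu μ, ω.1 = eInf μ ω.2) : muHatInf μ = μ := by
  apply Subtype.ext
  change (mixture μ : Measure (Outcomes L)).map (condMean μ Set.univ) = μ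
  rw [map_condMean_eq, ← map_fst_nu μ]
  exact Measure.map_congr (h.mono fun ω hω => hω.symm)

/-- If the conditional mean has the same distribution as `G`, then both have the same variance, so
the conditional variance vanishes. -/
lemma G_ae_eq_of_muHatInf_eq (hlin : LinearIndependent ℝ lam) (h : muHatInf μ = μ) :
    G lam =ᵐ[nu μ] (nu μ)[G lam | FInf lam] := by
  have hid : IdentDistrib (fun ω : Omega lam => eInf μ ω.2) (fun ω => ω.1) (nu μ) (nu μ) := by
    refine ⟨((measurable_condMean μ _).comp measurable_snd).aemeasurable,
      measurable_fst.aemeasurable, ?_⟩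
    have h1 := congrArg ProbabilityMeasure.toMeasure h
    change (mixture μ : Measure (Outcomes L)).map (condMean μ Set.univ) = μ at h1
    rw [map_condMean_eq, ← map_fst_nu μ] at h1
    exact h1
  have hcoord : ∀ k, ∀ᵐ ω ∂nu μ, G lam ω k = ((nu μ)[G lam | FInf lam]) ω k := by
    intro k
    set Y : Omega lam → ℝ := fun ω => G lam ω k with hY
    have hcomp : Measurable fun g : paramSet lam => (g : EuclideanSpace ℝ (Fin K)) k := by
      fun_prop
    have hYmem : MemLp Y 2 (nu μ) :=
      (EuclideanSpace.proj (𝕜 := ℝ) k).comp_memLp' (memLp_G (μ := μ) hlin 2)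
    have hE := condExp_G_apply_ae_eq (μ := μ) hlin (FInf lam) k
    have hvar : Var[(nu μ)[Y | FInf lam]; nu μ] = Var[Y; nu μ] := by
      refine Eq.trans (variance_congr ?_) (hid.comp hcomp).variance_eq
      filter_upwards [hE, condMean_ae_eq (μ := μ) hlin Set.univ] with ω h1 h2
      rw [← h1]
      exact congrArg (fun x : EuclideanSpace ℝ (Fin K) => x k) h2.symm
    have htot := integral_condVar_add_variance_condExp (FInf_le (lam := lam)) hYmem
    have hsq : Integrable ((Y - (nu μ)[Y | FInf lam]) ^ 2) (nu μ) :=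
      (hYmem.sub (MemLp.condExp one_le_two hYmem)).integrable_sq
    have hset := setIntegral_condVar (hm := FInf_le (lam := lam)) hsq MeasurableSet.univ
    rw [setIntegral_univ, setIntegral_univ] at hset
    have hzero : ∫ ω, (Y ω - ((nu μ)[Y | FInf lam]) ω) ^ 2 ∂nu μ = 0 := by
      rw [← hset]; linarith
    have hae := (integral_eq_zero_iff_of_nonneg (fun ω => sq_nonneg _) hsq).1 hzero
    filter_upwards [hae, hE] with ω h1 h2
    rw [h2]
    exact sub_eq_zero.1 (pow_eq_zero_iff two_ne_zero |>.1 h1)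
  filter_upwards [ae_all_iff.2 hcoord] with ω hω
  ext k
  exact hω k

lemma exists_dirac_condDistrib_of_ae_eq (h : ∀ᵐ ω ∂nu μ, ω.1 = eInf μ ω.2) :
    ∃ P : Omega lam → Measure (paramSet lam),
      IsRegularCondDistrib (FInf lam) (nu μ) (fun ω => ω.1) P ∧
      ∀ ω, ∃ g : paramSet lam, P ω {g} = 1 := by
  refine ⟨fun ω => Measure.dirac (eInf μ ω.2), ⟨fun ω => inferInstance, fun B hB => ?_,
    fun B hB => ?_⟩, fun ω => ⟨eInf μ ω.2, by simp⟩⟩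
  · exact (Measure.measurable_coe hB).comp
      (Measure.measurable_dirac.comp (measurable_comp_snd_FInf (measurable_condMean μ _)))
  · have hind : Measurable[FInf lam]
        fun ω : Omega lam => (B.indicator (fun _ => (1 : ℝ))) (eInf μ ω.2) :=
      measurable_comp_snd_FInf (f := fun a => (B.indicator (fun _ => (1 : ℝ))) (eInf μ a))
        ((measurable_const.indicator hB).comp (measurable_condMean μ _))
    have hae : (fun ω : Omega lam => (B.indicator (fun _ => (1 : ℝ))) (eInf μ ω.2)) =ᵐ[nu μ]
        ((fun ω : Omega lam => ω.1) ⁻¹' B).indicator fun _ => (1 : ℝ) := by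
      filter_upwards [h] with ω hω
      rw [← hω]
      rfl
    have hce := condExp_of_aestronglyMeasurable' (FInf_le (lam := lam))
      ⟨_, hind.stronglyMeasurable, hae.symm⟩
      ((integrable_const (μ := nu μ) (1 : ℝ)).indicator (measurable_fst hB))
    refine EventuallyEq.trans (Eventually.of_forall fun ω => ?_) (hae.trans hce.symm)
    by_cases hω : eInf μ ω.2 ∈ B <;> simp [measureReal_def, Measure.dirac_apply' _ hB, hω]

/-- If the regular conditional distribution of `G` is concentrated at a point `g(ω)`, then
`E(1_{G ∈ B} ∣ 𝓕^∞) = 1_{g ∈ B}` forces `1_{G ∈ B} = 1_{g ∈ B}`; countably many `B` separate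
points. -/
lemma G_ae_eq_of_dirac_condDistrib (hlin : LinearIndependent ℝ lam)
    {P : Omega lam → Measure (paramSet lam)}
    (hP : IsRegularCondDistrib (FInf lam) (nu μ) (fun ω => ω.1) P)
    (hpt : ∀ ω, ∃ g : paramSet lam, P ω {g} = 1) :
    G lam =ᵐ[nu μ] (nu μ)[G lam | FInf lam] := by
  choose g hg using hpt
  have hmem : ∀ ω B, MeasurableSet B → (g ω ∈ B → P ω B = 1) ∧ (g ω ∉ B → P ω B = 0) := by
    intro ω B hB
    have := hP.isProbabilityMeasure ω
    refine ⟨fun h => le_antisymm prob_le_one ?_, fun h => ?_⟩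
    · exact (hg ω).symm.le.trans (measure_mono (Set.singleton_subset_iff.2 h))
    · refine measure_mono_null (fun x hx => ?_)
        ((prob_compl_eq_zero_iff (measurableSet_singleton _)).2 (hg ω))
      rintro rfl
      exact h hx
  have hgm : Measurable[FInf lam] g := by
    intro B hB
    have : g ⁻¹' B = (fun ω => P ω B) ⁻¹' {1} := by
      ext ω
      constructor
      · exact fun h => (hmem ω B hB).1 h
      · intro h
        by_contra hn
        have h0 := (hmem ω B hB).2 hn
        simp only [Set.mem_preimage, Set.mem_singleton_iff] at h
        rw [h0] at h
        exact zero_ne_one h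
    rw [this]
    exact hP.measurable B hB (measurableSet_singleton _)
  have hsub : ∀ B, MeasurableSet B → ∀ᵐ ω ∂nu μ, ω.1 ∈ B → g ω ∈ B := by
    intro B hB
    have hC : MeasurableSet[FInf lam] (g ⁻¹' Bᶜ) := hgm hB.compl
    have hB' : MeasurableSet {ω : Omega lam | ω.1 ∈ B} := measurable_fst hB
    have h1 := setIntegral_condExp (FInf_le (lam := lam))
      ((integrable_const (μ := nu μ) (1 : ℝ)).indicator hB') hC
    have h2 : ∫ ω in g ⁻¹' Bᶜ,
        ((nu μ)⟦(fun ω : Omega lam => ω.1) ⁻¹' B | FInf lam⟧) ω ∂nu μ = 0 := by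
      refine (setIntegral_congr_ae (g := fun _ => (0 : ℝ)) (FInf_le _ hC) ?_).trans (by simp)
      filter_upwards [hP.ae_eq B hB] with ω hω hn
      rw [← hω, measureReal_def, (hmem ω B hB).2 hn, ENNReal.toReal_zero]
    have h3 := h1.symm.trans h2
    rw [setIntegral_indicator hB', setIntegral_const, smul_eq_mul, mul_one,
      measureReal_eq_zero_iff] at h3
    refine measure_mono_null (fun ω hω => ?_) h3
    have hω' : ¬ (ω.1 ∈ B → g ω ∈ B) := hω
    push Not at hω'
    exact ⟨hω'.2, hω'.1⟩
  have hae : ∀ᵐ ω ∂nu μ, g ω = ω.1 := by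
    refine Filter.EventuallyEq.of_forall_separating_mem_iff MeasurableSet fun B hB => ?_
    filter_upwards [hsub B hB, hsub Bᶜ hB.compl] with ω h1 h2
    exact ⟨fun h => by_contra fun hn => h2 hn h, h1⟩
  exact G_ae_eq_condExp_of_ae_eq hlin hgm (hae.mono fun ω hω => hω.symm)

end Bayes
/-! ### Singularity and sufficiency -/

section Singular

variable {L : ℕ → ℕ} {K : ℕ} {lam : Fin K → BetaSpace L}

lemma mutuallySingular_of_ae_eq_const {Ω E : Type*} [MeasurableSpace Ω] [MeasurableSpace E]
    [MeasurableSingletonClass E] {P Q : Measure Ω} {f : Ω → E} (hf : Measurable f) {x y : E}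
    (hxy : x ≠ y) (hx : ∀ᵐ a ∂P, f a = x) (hy : ∀ᵐ a ∂Q, f a = y) : P ⟂ₘ Q := by
  refine ⟨f ⁻¹' {y}, hf (measurableSet_singleton y), ?_, hy⟩
  exact measure_mono_null (t := {a | ¬ f a = x}) (fun a ha h => hxy (h.symm.trans ha)) hx

/-- Any two points of `Q` are atoms of some prior. -/
lemma exists_prior_atoms (g' g'' : paramSet lam) :
    ∃ μ : ProbabilityMeasure (paramSet lam), (μ : Measure (paramSet lam)) {g'} ≠ 0 ∧
      (μ : Measure (paramSet lam)) {g''} ≠ 0 := by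
  refine ⟨⟨(2⁻¹ : ENNReal) • Measure.dirac g' + (2⁻¹ : ENNReal) • Measure.dirac g'',
    ⟨by simp [ENNReal.inv_two_add_inv_two]⟩⟩, ?_, ?_⟩
  · simp
  · simp

lemma exists_family_real_ne (hlin : LinearIndependent ℝ lam) {g' g'' : paramSet lam}
    (hne : g' ≠ g'') :
    ∃ B, MeasurableSet B ∧ (family lam g').real B ≠ (family lam g'').real B := by
  by_contra! h
  refine hne (Subtype.ext (betaMap_injective hlin (funext fun j => funext fun l => ?_)))
  have hB : MeasurableSet ((fun a : Outcomes L => a j) ⁻¹' {l}) :=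
    measurable_pi_apply j (measurableSet_singleton l)
  have hval : ∀ g : paramSet lam,
      (family lam g).real ((fun a : Outcomes L => a j) ⁻¹' {l}) = betaMap lam g.1 j l := by
    intro g
    rw [← map_measureReal_apply (measurable_pi_apply j) (measurableSet_singleton l)]
    refine Eq.trans ?_ (coordMeasure_real_singleton (betaBody lam g) j l)
    congr 1
    exact Measure.infinitePi_map_eval (fun j => coordMeasure (betaBody lam g).1 j) j
  rw [← hval g', ← hval g'']
  exact h _ hB

lemma mutuallySingular_of_fst_ae_eq
    (h : ∀ μ : ProbabilityMeasure (paramSet lam), ∀ᵐ ω ∂nu μ, ω.1 = eInf μ ω.2)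
    {g' g'' : paramSet lam} (hne : g' ≠ g'') : family lam g' ⟂ₘ family lam g'' := by
  obtain ⟨μ, h1, h2⟩ := exists_prior_atoms g' g''
  exact mutuallySingular_of_ae_eq_const (measurable_condMean μ Set.univ) hne
    ((ae_family_of_ae_nu (h μ) h1).mono fun a ha => ha.symm)
    ((ae_family_of_ae_nu (h μ) h2).mono fun a ha => ha.symm)

/-- A common version of the conditional probabilities given the tail σ-algebra, which are constant
under each `P_g`, takes different constant values under different `P_g`. -/
lemma mutuallySingular_of_isSufficient_tail (hlin : LinearIndependent ℝ lam)
    (h : ∀ μ : ProbabilityMeasure (paramSet lam), ∃ Q₁ : Set (paramSet lam), MeasurableSet Q₁ ∧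
      (μ : Measure (paramSet lam)) Q₁ = 1 ∧
      IsSufficient (tail L) (fun g : Q₁ => family lam g.1))
    {g' g'' : paramSet lam} (hne : g' ≠ g'') : family lam g' ⟂ₘ family lam g'' := by
  obtain ⟨μ, h1, h2⟩ := exists_prior_atoms g' g''
  obtain ⟨Q₁, hQ, hμ, -, P, hPm, -, hP⟩ := h μ
  have hmem : ∀ g, (μ : Measure (paramSet lam)) {g} ≠ 0 → g ∈ Q₁ := by
    intro g hg
    by_contra hn
    exact hg (measure_mono_null (Set.singleton_subset_iff.2 hn)
      ((prob_compl_eq_zero_iff hQ).2 hμ))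
  obtain ⟨B, hB, hBne⟩ := exists_family_real_ne hlin hne
  have hPB : Measurable fun a => (P a).real B :=
    (Measurable.mono (hPm B hB) (tail_le L) le_rfl).ennreal_toReal
  have hae : ∀ g ∈ Q₁, ∀ᵐ a ∂family lam g, (P a).real B = (family lam g).real B := fun g hg =>
    (hP B hB ⟨g, hg⟩).trans (condExp_indicator_tail (betaBody lam g) hB)
  exact mutuallySingular_of_ae_eq_const hPB hBne (hae _ (hmem _ h1)) (hae _ (hmem _ h2))

/-- The tail measurable function `f` which recovers `g` shows that the tail σ-algebra is sufficient:
the measure `P_{f(a)}` is a common version of the conditional probabilities. -/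
lemma isSufficient_tail_of_info (hmem : ∀ k, lam k ∈ paramBody L)
    (h : ∀ v : EuclideanSpace ℝ (Fin K), v ≠ 0 →
      Tendsto (fun n => info lam (Finset.range n) v v) atTop atTop)
    (μ : ProbabilityMeasure (paramSet lam)) (Q₁ : Set (paramSet lam)) :
    IsSufficient (tail L) (fun g : Q₁ => family lam g.1) := by
  have := nonempty_paramSet μ
  obtain ⟨f, hf, hfg⟩ := exists_tail_estimator hmem h
  refine ⟨tail_le L, fun a => family lam (f a), fun B hB => ?_, fun a => inferInstance,
    fun B hB g => ?_⟩
  · exact ((family lam).measurable_coe hB).comp hf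
  · filter_upwards [hfg g.1, condExp_indicator_tail (betaBody lam g.1) hB] with a h1 h2
    rw [h1]
    exact h2.symm

lemma G_ae_eq_of_info (hmem : ∀ k, lam k ∈ paramBody L) (hlin : LinearIndependent ℝ lam)
    (h : ∀ v : EuclideanSpace ℝ (Fin K), v ≠ 0 →
      Tendsto (fun n => info lam (Finset.range n) v v) atTop atTop)
    (μ : ProbabilityMeasure (paramSet lam)) :
    G lam =ᵐ[nu μ] (nu μ)[G lam | FInf lam] := by
  have := nonempty_paramSet μ
  obtain ⟨f, hf, hfg⟩ := exists_tail_estimator hmem h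
  have hf' : Measurable f := hf.mono (tail_le L) le_rfl
  have hae : ∀ᵐ ω ∂nu μ, ω.1 = f ω.2 := ae_nu_of_forall_ae_family
    (measurableSet_eq_fun measurable_fst (hf'.comp measurable_snd))
    fun g => (hfg g).mono fun a ha => ha.symm
  exact G_ae_eq_condExp_of_ae_eq hlin (measurable_comp_snd_FInf hf') hae

end Singular
end LLS

theorem mainTheorem1 (L : ℕ → ℕ) (K : ℕ) (lam : Fin K → LLS.BetaSpace L)
    (hmem : ∀ k, lam k ∈ LLS.paramBody L) (hlin : LinearIndependent ℝ lam) :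
    List.TFAE [
      -- (1)
      ∀ μ : ProbabilityMeasure (LLS.paramSet lam),
        Tendsto (fun n => LLS.muHat μ n) atTop (𝓝 μ),
      -- (2)
      ∀ μ : ProbabilityMeasure (LLS.paramSet lam), LLS.muHatInf μ = μ,
      -- (3)
      ∀ μ : ProbabilityMeasure (LLS.paramSet lam),
        LLS.nu μ {ω | ω.1 = LLS.eInf μ ω.2} = 1,
      -- (4)
      ∀ μ : ProbabilityMeasure (LLS.paramSet lam),
        LLS.G lam =ᵐ[LLS.nu μ] (LLS.nu μ)[LLS.G lam | LLS.FInf lam],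
      -- (5)
      ∀ μ : ProbabilityMeasure (LLS.paramSet lam),
        ∃ P : LLS.Omega lam → Measure (LLS.paramSet lam),
          LLS.IsRegularCondDistrib (LLS.FInf lam) (LLS.nu μ) (fun ω => ω.1) P ∧
          ∀ ω, ∃ g : LLS.paramSet lam, P ω {g} = 1,
      -- (6)
      ∀ μ : ProbabilityMeasure (LLS.paramSet lam),
        ∃ Q₁ : Set (LLS.paramSet lam), MeasurableSet Q₁ ∧ (μ : Measure (LLS.paramSet lam)) Q₁ = 1 ∧
          LLS.IsSufficient (LLS.tail L) (fun g : Q₁ => LLS.family lam g.1),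
      -- (7)
      ∀ g' g'' : LLS.paramSet lam, g' ≠ g'' → LLS.family lam g' ⟂ₘ LLS.family lam g'',
      -- (8)
      ∀ g' g'' : LLS.paramSet lam, g' ≠ g'' →
        Tendsto (fun n : ℕ => ∏ j ∈ Finset.range n, ∑ l,
          √(LLS.betaMap lam g'.1 j l * LLS.betaMap lam g''.1 j l)) atTop (𝓝 0),
      -- (9)
      ∀ g' g'' : LLS.paramSet lam, g' ≠ g'' →
        Tendsto (fun n : ℕ => ∑ j ∈ Finset.range n, ∑ l,
          (√(LLS.betaMap lam g'.1 j l) - √(LLS.betaMap lam g''.1 j l)) ^ 2) atTop atTop] := by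
  tfae_have 1 → 2 := fun h μ => tendsto_nhds_unique (LLS.tendsto_muHat hlin) (h μ)
  tfae_have 2 → 1 := fun h μ => by
    simpa only [h μ] using LLS.tendsto_muHat (μ := μ) hlin
  tfae_have 2 → 4 := fun h μ => LLS.G_ae_eq_of_muHatInf_eq hlin (h μ)
  tfae_have 4 → 3 := fun h μ => LLS.nu_eq_one_iff.2 (LLS.fst_ae_eq_eInf_of_G_ae_eq hlin (h μ))
  tfae_have 3 → 2 := fun h μ => LLS.muHatInf_eq_of_ae_eq (LLS.nu_eq_one_iff.1 (h μ))
  tfae_have 3 → 5 := fun h μ => LLS.exists_dirac_condDistrib_of_ae_eq (LLS.nu_eq_one_iff.1 (h μ))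
  tfae_have 5 → 4 := by
    intro h μ
    obtain ⟨P, hP, hpt⟩ := h μ
    exact LLS.G_ae_eq_of_dirac_condDistrib hlin hP hpt
  tfae_have 3 → 7 := fun h _ _ hne =>
    LLS.mutuallySingular_of_fst_ae_eq (fun μ => LLS.nu_eq_one_iff.1 (h μ)) hne
  tfae_have 6 → 7 := fun h _ _ hne => LLS.mutuallySingular_of_isSufficient_tail hlin h hne
  tfae_have 7 → 8 := fun h g' g'' hne =>
    LLS.tendsto_prod_affinity_of_mutuallySingular (β := LLS.betaBody lam g')
      (γ := LLS.betaBody lam g'') (h g' g'' hne)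
  tfae_have 8 → 9 := fun h _ _ hne => LLS.tendsto_sum_hellinger_of_tendsto_prod_affinity h hne
  tfae_have 9 → 4 := fun h μ => LLS.G_ae_eq_of_info hmem hlin
    (fun _ hv => LLS.tendsto_info_atTop hmem h hv) μ
  tfae_have 9 → 6 := fun h μ => ⟨Set.univ, MeasurableSet.univ, measure_univ,
    LLS.isSufficient_tail_of_info hmem (fun _ hv => LLS.tendsto_info_atTop hmem h hv) μ _⟩
  tfae_finish
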